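/- Let $M$ be a smooth manifold of dimension $n+1$ and let $\pi : M \to \mathbb{R}$ be a fibration (a smooth surjective submersion). Put $\eta = \pi^*(dt)$, let $\pi_M : T^*M \to M$ be the projection and $\tilde\pi_M = \pi\circ\pi_M : T^*M \to \mathbb{R}$. The spaces of $1$-jets of local sections are identified with $$J^1\pi = \{v\in TM : \eta(v) = 1\},\qquad J^1\tilde\pi_M = \{z \in T(T^*M) : d\tilde\pi_M(z) = 1\}.$$ Let $V^*\pi$ be the dual of the vertical bundle $V\pi=\ker\eta$ and $\mu : T^*M\to V^*\pi$ the restriction map. Let $\Omega_M = dq^i\wedge dp_i$ be the canonical symplectic form of $T^*M$ (canonical coordinates, the coordinate $t$ of $M$ being included among the $q^i$), and $\Omega_M^c = dq^i\wedge d\dot p_i + d\dot q^i\wedge dp_i$ its complete lift to $T(T^*M)$. Then $J^1\tilde\pi_M$ is a presymplectic manifold with the pull-back $\Omega_{J^1\tilde\pi_M}$ of $\Omega_M^c$. Let $A_M : T(T^*M)\to T^*(TM)$ be the canonical Tulczyjew diffeomorphism, $A_M(q,p;\dot q,\dot p) = (q,\dot q;\dot p,p)$, and define $$\widetilde{A_\pi}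 : J^1\tilde\pi_M \to T^*(J^1\pi),\qquad \widetilde{A_\pi}(z) = A_M(z)|_{T_v(J^1\pi)},\quad v = T\pi_M(z)\in J^1\pi,$$ $$\widetilde{b_\pi} : J^1\tilde\pi_M\to T^*(T^*M),\qquad \widetilde{b_\pi}(z) = \Omega_M(z,\cdot).$$ Let $L : J^1\pi\to\mathbb{R}$ be a smooth Lagrangian function with extended Legendre transformation $$\mathrm{Leg}_L : J^1\pi\to T^*M,\qquad \mathrm{Leg}_L(v)(X) = L(v)\,\eta(X) + \frac{d}{dt}\Big|_{t=0} L\big(v + t(X-\eta(X)v)\big),$$ and restricted Legendre transformation $\mathrm{leg}_L = \mu\circ \mathrm{Leg}_L : J^1\pi\to V^*\pi$. Suppose that $L$ is hyperregular, that is, $\mathrm{leg}_L$ is a diffeomorphism. Let $h = \mathrm{Leg}_L\circ \mathrm{leg}_L^{-1} : V^*\pi\to T^*M$ be the associated Hamiltonian section, and let $F_h : T^*M\to\mathbb{R}$ be the associated function, determined by $\alpha = h(\mu(\alpha)) + F_h(\alpha)\,\eta$ for all $\alpha\in T^*M$. **Theorem.** The sets $$\widetilde{S_L} = \widetilde{A_\pi}^{-1}\big(dL(J^1\pi)\big),\qquad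 \widetilde{S_h} = \widetilde{b_\pi}^{-1}\big(dF_h(T^*M)\big)$$ are Lagrangian submanifolds of the presymplectic manifold $(J^1\tilde\pi_M,\Omega_{J^1\tilde\pi_M})$, and $\widetilde{S_L} = \widetilde{S_h}$. Here a submanifold $C$ of dimension $r$ of a presymplectic manifold $(J,\omega)$ is Lagrangian if $\omega$ vanishes on each $T_xC$ and $r = \tfrac12 \operatorname{rank}\omega(x) + \dim\big(T_xC\cap\ker\omega(x)\big)$ for every $x\in C$. -/

import Mathlib

open scoped Manifold ContDiff

noncomputable section

namespace TimeDependentMechanics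

universe u

section General

variable {E : Type*} [NormedAddCommGroup E] [NormedSpace ℝ E]
  {H : Type*} [TopologicalSpace H] (I : ModelWithCorners ℝ E H)
  {N : Type*} [TopologicalSpace N] [ChartedSpace H N]

/-- The differential at `x` of a real function `τ` on a manifold, as a covector.
For `τ = π` this is the value at `x` of the 1-form `η = π^*(dt)`. -/
def differential (τ : N → ℝ) (x : N) : TangentSpace I x →L[ℝ] ℝ :=
  mfderiv I 𝓘(ℝ, ℝ) τ x

/-- The space of 1-jets of local sections of `τ : N → ℝ`, identified in the usual way with
the subset `{v | dτ(v) = 1}` of the tangent bundle `TN`. -/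
def jetSpace (τ : N → ℝ) : Set (TangentBundle I N) :=
  {v | differential I τ v.1 v.2 = 1}

/-- The cotangent bundle of a manifold. Topology and smooth structure are those of Mathlib's
vector bundle of continuous linear maps. -/
abbrev CotangentBundle (N : Type*) [TopologicalSpace N] [ChartedSpace H N]
    [IsManifold I 1 N] :=
  Bundle.TotalSpace (E →L[ℝ] ℝ) (fun x : N => TangentSpace I x →L[ℝ] Bundle.Trivial N ℝ x)

variable [IsManifold I 1 N]

/-- The tangent space at `v` of the hypersurface `jetSpace I τ` of `TN`: this hypersurface is
the level set at `1` of the function `w ↦ dτ(w)` on `TN`, so its tangent space is the kernel of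
the differential of that function. -/
def jetTangent (τ : N → ℝ) (v : TangentBundle I N) :
    Submodule ℝ (TangentSpace I.tangent v) :=
  LinearMap.ker (differential I.tangent
    (fun w : TangentBundle I N => differential I τ w.1 w.2) v).toLinearMap

/-- The cotangent bundle (as a set) of the manifold `jetSpace I τ`. -/
abbrev JetCotangent (τ : N → ℝ) :=
  Σ v : jetSpace I τ, (jetTangent I τ (v : TangentBundle I N) →L[ℝ] ℝ)

/-- A fibration `π : N → ℝ`: a smooth surjective submersion. -/
structure IsFibration (τ : N → ℝ) : Prop where
  smooth : ContMDiff I 𝓘(ℝ, ℝ) ∞ τ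
  surjective : Function.Surjective τ
  submersion : ∀ x, Function.Surjective (differential I τ x)

end General

section Lagrangian

variable {E : Type*} [NormedAddCommGroup E] [NormedSpace ℝ E]
  {H : Type*} [TopologicalSpace H] (I : ModelWithCorners ℝ E H)
  {N : Type u} [TopologicalSpace N] [ChartedSpace H N]

/-- Let `J ⊆ N` be an embedded submanifold with tangent spaces `TJ`, and let `σ` be a 2-form
on `N`, whose pull-back to `J` makes `J` a presymplectic manifold. A subset `C` of `J` is a
Lagrangian submanifold of `J` if it is an embedded submanifold, i.e. the image of a smooth
embedding `f` of some manifold `P` of some dimension `r`, if `σ` vanishes on the tangent spaces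
`T_xC = range (T_p f)`, `x = f p`, and if
`r = rank (σ|_J (x)) / 2 + dim (T_xC ∩ Ker (σ|_J (x)))` at all points `x` of `C`. -/
def IsLagrangianSubmanifold (J : Set N) (TJ : ∀ x : N, Submodule ℝ (TangentSpace I x))
    (σ : ∀ x : N, TangentSpace I x →L[ℝ] TangentSpace I x →L[ℝ] ℝ) (C : Set J) : Prop :=
  ∃ (F : Type) (_ : NormedAddCommGroup F) (_ : NormedSpace ℝ F) (_ : FiniteDimensional ℝ F)
    (P : Type u) (_ : TopologicalSpace P) (_ : ChartedSpace F P) (_ : IsManifold 𝓘(ℝ, F) ∞ P)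
    (f : P → N),
    ContMDiff 𝓘(ℝ, F) I ∞ f ∧
    Topology.IsEmbedding f ∧
    (∀ p, Function.Injective (mfderiv 𝓘(ℝ, F) I f p)) ∧
    Set.range f = Subtype.val '' C ∧
    ∀ p : P,
      let TC : Submodule ℝ (TangentSpace I (f p)) :=
        LinearMap.range (mfderiv 𝓘(ℝ, F) I f p).toLinearMap
      -- the flat map `T_xJ → (T_xJ)^*` of the restriction of `σ` to `J`
      let flat : TJ (f p) →ₗ[ℝ] (TJ (f p) →L[ℝ] ℝ) :=
        { toFun := fun a => (σ (f p) a).comp (TJ (f p)).subtypeL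
          map_add' := fun a b => by ext c; simp
          map_smul' := fun s a => by ext c; simp }
      (∀ a ∈ TC, ∀ b ∈ TC, σ (f p) a b = 0) ∧
      2 * Module.finrank ℝ F =
        Module.finrank ℝ (LinearMap.range flat) +
          2 * Module.finrank ℝ ↥(TC ⊓ (LinearMap.ker flat).map (TJ (f p)).subtype)

end Lagrangian

section Mechanics

variable {E : Type*} [NormedAddCommGroup E] [NormedSpace ℝ E]
  {M : Type u} [TopologicalSpace M] [ChartedSpace E M] [IsManifold 𝓘(ℝ, E) ∞ M]

/-- The model with corners of the cotangent bundle `T^*M`. -/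
abbrev cotModel (E : Type*) [NormedAddCommGroup E] [NormedSpace ℝ E] :=
  (𝓘(ℝ, E)).prod 𝓘(ℝ, E →L[ℝ] ℝ)

variable (M) in
/-- The projection `π_M : T^*M → M`. -/
def cotProj (α : CotangentBundle 𝓘(ℝ, E) M) : M := α.1

/-- The fibration `π̃_M = π ∘ π_M : T^*M → ℝ`. -/
def cotTime (π : M → ℝ) (α : CotangentBundle 𝓘(ℝ, E) M) : ℝ := π (cotProj M α)

/-! ### Canonical structures on `T^*M`

For a point `x` of a manifold, Mathlib's `TangentSpace I x` *is* the model vector space, through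
the preferred chart at `x`. The preferred chart of `T^*M` at `α` (resp. of `TM` at `v`, of
`T(T^*M)` at `z`) is the one induced by the preferred chart of `M` at the base point of `α`
(resp. `v`, resp. `z`). Hence, writing `(q, p)`, `(q, q̇)` and `(q, p; q̇, ṗ)` for the
induced coordinates (with all coordinates of `M`, including time, in `q`):
* `ξ ∈ T_α(T^*M)` is the pair `(δq, δp) ∈ E × E^*`;
* `W ∈ T_v(TM)` is the pair `(δq, δq̇) ∈ E × E`;
* `ζ ∈ T_z(T(T^*M))` is the pair `((δq, δp), (δq̇, δṗ))`.
The definitions below are the canonical objects written in these canonical coordinates. -/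

/-- The bilinear form `(a, b) ↦ P(a, b) - P(b, a)`. -/
def antisymmetrize {V : Type*} [NormedAddCommGroup V] [NormedSpace ℝ V]
    (P : V →L[ℝ] V →L[ℝ] ℝ) : V →L[ℝ] V →L[ℝ] ℝ := P - P.flip

/-- The bilinear form `dq^i ∧ dp_i`, that is `((δq, δp), (δ'q, δ'p)) ↦ δ'p(δq) - δp(δ'q)`. -/
def darboux (E : Type*) [NormedAddCommGroup E] [NormedSpace ℝ E] :
    (E × (E →L[ℝ] ℝ)) →L[ℝ] (E × (E →L[ℝ] ℝ)) →L[ℝ] ℝ :=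
  antisymmetrize ((ContinuousLinearMap.apply ℝ ℝ).bilinearComp
    (ContinuousLinearMap.fst ℝ E (E →L[ℝ] ℝ)) (ContinuousLinearMap.snd ℝ E (E →L[ℝ] ℝ)))

theorem darboux_apply (a b : E × (E →L[ℝ] ℝ)) : darboux E a b = b.2 a.1 - a.2 b.1 := rfl

/-- The canonical symplectic structure `Ω_M = dq^i ∧ dp_i` of `T^*M`. -/
def canonicalSymplectic (α : CotangentBundle 𝓘(ℝ, E) M) :
    TangentSpace (cotModel E) α →L[ℝ] TangentSpace (cotModel E) α →L[ℝ] ℝ :=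
  darboux E

/-- The complete lift `Ω_M^c = dq^i ∧ dṗ_i + dq̇^i ∧ dp_i` to `T(T^*M)` of `Ω_M`. For a 2-form
`ω` with constant coefficients, as `Ω_M` is in canonical coordinates, the complete lift is
`ω^c ((δ, ε), (δ', ε')) = ω (δ, ε') + ω (ε, δ')`. -/
def completeLift (z : TangentBundle (cotModel E) (CotangentBundle 𝓘(ℝ, E) M)) :
    TangentSpace (cotModel E).tangent z →L[ℝ] TangentSpace (cotModel E).tangent z →L[ℝ] ℝ :=
  let Y := E × (E →L[ℝ] ℝ)
  (darboux E).bilinearComp (ContinuousLinearMap.fst ℝ Y Y) (ContinuousLinearMap.snd ℝ Y Y) +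
    (darboux E).bilinearComp (ContinuousLinearMap.snd ℝ Y Y) (ContinuousLinearMap.fst ℝ Y Y)

/-- The vector bundle isomorphism `b_M : T(T^*M) → T^*(T^*M)`, `b_M(z) = Ω_M(z, ·)`. -/
def flatMap (z : TangentBundle (cotModel E) (CotangentBundle 𝓘(ℝ, E) M)) :
    CotangentBundle (cotModel E) (CotangentBundle 𝓘(ℝ, E) M) :=
  ⟨z.1, canonicalSymplectic z.1 z.2⟩

/-- The canonical Tulczyjew diffeomorphism `A_M : T(T^*M) → T^*(TM)`. In canonical coordinates
`A_M(q, p; q̇, ṗ) = (q, q̇; ṗ, p)`: the value of `A_M(z)` is the covector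
`(δq, δq̇) ↦ ṗ(δq) + p(δq̇)` at the point `Tπ_M(z) = (q, q̇)` of `TM`. -/
def tulczyjew (z : TangentBundle (cotModel E) (CotangentBundle 𝓘(ℝ, E) M)) :
    CotangentBundle (𝓘(ℝ, E)).tangent (TangentBundle 𝓘(ℝ, E) M) :=
  let p : E →L[ℝ] ℝ := z.1.2
  let ζ : E × (E →L[ℝ] ℝ) := z.2
  let β : E × E →L[ℝ] ℝ :=
    ζ.2.comp (ContinuousLinearMap.fst ℝ E E) + p.comp (ContinuousLinearMap.snd ℝ E E)
  ⟨tangentMap (cotModel E) 𝓘(ℝ, E) (cotProj M) z, β⟩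

/-! ### The vertical dual, Legendre transformations, hyperregularity -/

/-- The dual bundle `V^*π` of the vertical bundle `Vπ = {v ∈ TM | η(v) = 0}`. -/
abbrev VerticalDual (π : M → ℝ) :=
  Σ x : M, (LinearMap.ker (differential 𝓘(ℝ, E) π x).toLinearMap →L[ℝ] ℝ)

/-- The canonical projection `μ : T^*M → V^*π`, restriction of covectors to `Vπ`. -/
def mu (π : M → ℝ) (α : CotangentBundle 𝓘(ℝ, E) M) : VerticalDual (E := E) π :=
  ⟨α.1, ContinuousLinearMap.comp (show TangentSpace 𝓘(ℝ, E) α.1 →L[ℝ] ℝ from α.2)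
    (Submodule.subtypeL _)⟩

/-- The principal action of `s ∈ ℝ` on `T^*M`: `α ↦ α + s η`. -/
def translate (π : M → ℝ) (s : ℝ) (α : CotangentBundle 𝓘(ℝ, E) M) :
    CotangentBundle 𝓘(ℝ, E) M :=
  ⟨α.1, (show TangentSpace 𝓘(ℝ, E) α.1 →L[ℝ] ℝ from α.2) + s • differential 𝓘(ℝ, E) π α.1⟩

/-- The extended Legendre transformation `Leg_L : J^1π → T^*M`,
`Leg_L(v)(X) = L(v) η(X) + d/dt|_{t=0} L(v + t (X - η(X) v))`. The last term is the directional
derivative at `0` in the direction `X` of the function `X ↦ L(v + (X - η(X) v))` on `T_xM`. -/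
def Leg (π : M → ℝ) (L : TangentBundle 𝓘(ℝ, E) M → ℝ) (v : jetSpace 𝓘(ℝ, E) π) :
    CotangentBundle 𝓘(ℝ, E) M :=
  ⟨v.1.1, L v.1 • differential 𝓘(ℝ, E) π v.1.1 +
    fderiv ℝ (fun X : TangentSpace 𝓘(ℝ, E) v.1.1 =>
      L ⟨v.1.1, v.1.2 + (X - differential 𝓘(ℝ, E) π v.1.1 X • v.1.2)⟩) 0⟩

/-- The defining formula of `Leg_L`, for `L` differentiable on the fibre. -/
theorem Leg_apply (π : M → ℝ) (L : TangentBundle 𝓘(ℝ, E) M → ℝ) (v : jetSpace 𝓘(ℝ, E) π)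
    (hd : DifferentiableAt ℝ (fun X : TangentSpace 𝓘(ℝ, E) v.1.1 =>
      L ⟨v.1.1, v.1.2 + (X - differential 𝓘(ℝ, E) π v.1.1 X • v.1.2)⟩) 0)
    (X : TangentSpace 𝓘(ℝ, E) v.1.1) :
    (Leg π L v).2 X = L v.1 * differential 𝓘(ℝ, E) π v.1.1 X +
      deriv (fun t : ℝ =>
        L ⟨v.1.1, v.1.2 + t • (X - differential 𝓘(ℝ, E) π v.1.1 X • v.1.2)⟩) 0 := by
  have key : ∀ g : E → ℝ, DifferentiableAt ℝ g 0 → ∀ Y : E,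
      fderiv ℝ g 0 Y = deriv (fun t : ℝ => g (t • Y)) 0 := by
    intro g hg Y
    have := hg.lineDeriv_eq_fderiv (v := Y)
    simpa [lineDeriv] using this.symm
  have h2 := key _ hd X
  have h3 : (Leg π L v).2 X = L v.1 * differential 𝓘(ℝ, E) π v.1.1 X +
    fderiv ℝ (fun X : TangentSpace 𝓘(ℝ, E) v.1.1 =>
      L ⟨v.1.1, v.1.2 + (X - differential 𝓘(ℝ, E) π v.1.1 X • v.1.2)⟩) 0 X := rfl
  refine h3.trans (congrArg _ (h2.trans ?_))
  congr 1
  funext t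
  change L ⟨v.1.1, v.1.2 + (t • X - differential 𝓘(ℝ, E) π v.1.1 (t • X) • v.1.2)⟩ = _
  rw [map_smul, smul_sub, smul_smul, smul_eq_mul]

/-- The restricted Legendre transformation `leg_L = μ ∘ Leg_L : J^1π → V^*π`. -/
def leg (π : M → ℝ) (L : TangentBundle 𝓘(ℝ, E) M → ℝ) (v : jetSpace 𝓘(ℝ, E) π) :
    VerticalDual (E := E) π :=
  mu π (Leg π L v)

/-- `L` is hyperregular if `leg_L : J^1π → V^*π` is a (global) diffeomorphism. The smooth
structure of `V^*π` is the unique one for which `μ : T^*M → V^*π` is a surjective submersion: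
a map into `V^*π` is smooth iff it has local smooth lifts to `T^*M`, and a map `g` defined on
`V^*π` is smooth iff `g ∘ μ` is. Smoothness of maps from and to `J^1π` refers to `J^1π` as an
embedded submanifold of `TM`. -/
structure IsHyperregular (π : M → ℝ) (L : TangentBundle 𝓘(ℝ, E) M → ℝ) : Prop where
  bijective : Function.Bijective (leg π L)
  smooth : ∀ v₀ : jetSpace 𝓘(ℝ, E) π, ∃ U : Set (TangentBundle 𝓘(ℝ, E) M), IsOpen U ∧ v₀.1 ∈ U ∧
    ∃ f : TangentBundle 𝓘(ℝ, E) M → CotangentBundle 𝓘(ℝ, E) M,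
      ContMDiffOn (𝓘(ℝ, E)).tangent (cotModel E) ∞ f (U ∩ jetSpace 𝓘(ℝ, E) π) ∧
      ∀ v : jetSpace 𝓘(ℝ, E) π, v.1 ∈ U → mu π (f v) = leg π L v
  smooth_symm : ContMDiff (cotModel E) (𝓘(ℝ, E)).tangent ∞
    (fun α : CotangentBundle 𝓘(ℝ, E) M =>
      (((Equiv.ofBijective (leg π L) bijective).symm (mu π α) : jetSpace 𝓘(ℝ, E) π) :
        TangentBundle 𝓘(ℝ, E) M))

/-- The Hamiltonian section `h = Leg_L ∘ leg_L⁻¹ : V^*π → T^*M` of a hyperregular `L`. -/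
def hamiltonianSection {π : M → ℝ} {L : TangentBundle 𝓘(ℝ, E) M → ℝ}
    (hL : IsHyperregular π L) (β : VerticalDual (E := E) π) : CotangentBundle 𝓘(ℝ, E) M :=
  Leg π L ((Equiv.ofBijective (leg π L) hL.bijective).symm β)

/-- The function `F_h` on `T^*M` associated with a section `h` of `μ`: `F_h(α)` is the unique
real number `s` such that `α = h(μ(α)) + s η`. In coordinates, `F_h = p + H` for
`h(t, q, p_i) = (t, q, -H(t, q, p_i), p_i)`. -/
def sectionFunction (π : M → ℝ) (h : VerticalDual (E := E) π → CotangentBundle 𝓘(ℝ, E) M)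
    (α : CotangentBundle 𝓘(ℝ, E) M) : ℝ :=
  Classical.epsilon fun s : ℝ => α = translate π s (h (mu π α))

/-- `F_h(α)` is well defined: it is the unique `s` with `α = h(μ(α)) + s η`. -/
theorem sectionFunction_spec {π : M → ℝ} (hπ : IsFibration 𝓘(ℝ, E) π)
    {h : VerticalDual (E := E) π → CotangentBundle 𝓘(ℝ, E) M} (hh : ∀ β, mu π (h β) = β)
    (α : CotangentBundle 𝓘(ℝ, E) M) (s : ℝ) :
    α = translate π s (h (mu π α)) ↔ sectionFunction π h α = s := by
  obtain ⟨w, hw⟩ := hπ.submersion α.1 1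
  have huniq : ∀ s s' : ℝ, ∀ γ : CotangentBundle 𝓘(ℝ, E) M, γ.1 = α.1 →
      translate π s γ = translate π s' γ → s = s' := by
    rintro s s' ⟨x, p⟩ rfl h
    have h1 := eq_of_heq (Bundle.TotalSpace.mk.inj h).2
    have h2 := DFunLike.congr_fun h1 w
    have h3 : p w + s * differential 𝓘(ℝ, E) π α.1 w = p w + s' * differential 𝓘(ℝ, E) π α.1 w := h2
    rw [hw] at h3
    linarith
  have hbase : (h (mu π α)).1 = α.1 := congrArg Sigma.fst (hh (mu π α))
  have hex : ∃ s : ℝ, α = translate π s (h (mu π α)) := by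
    have hm := hh (mu π α)
    generalize h (mu π α) = γ at hm hbase
    obtain ⟨x, p⟩ := α
    obtain ⟨y, q⟩ := γ
    obtain rfl : y = x := hbase
    have h1 := eq_of_heq (Sigma.mk.inj hm).2
    let p' : TangentSpace 𝓘(ℝ, E) y →L[ℝ] ℝ := p
    let q' : TangentSpace 𝓘(ℝ, E) y →L[ℝ] ℝ := q
    refine ⟨p' w - q' w, ?_⟩
    have key : p' = q' + (p' w - q' w) • differential 𝓘(ℝ, E) π y := by
      ext X
      have hX : X - differential 𝓘(ℝ, E) π y X • w ∈
          LinearMap.ker (differential 𝓘(ℝ, E) π y).toLinearMap := by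
        change differential 𝓘(ℝ, E) π y (X - differential 𝓘(ℝ, E) π y X • w) = 0
        rw [map_sub, map_smul, hw]; simp
      have h2 : q' (X - differential 𝓘(ℝ, E) π y X • w) =
        p' (X - differential 𝓘(ℝ, E) π y X • w) := DFunLike.congr_fun h1 ⟨_, hX⟩
      rw [map_sub, map_sub, map_smul, map_smul, smul_eq_mul, smul_eq_mul] at h2
      change p' X = q' X + (p' w - q' w) * differential 𝓘(ℝ, E) π y X
      linarith
    exact congrArg (Bundle.TotalSpace.mk y) key
  have hspec := Classical.epsilon_spec hex
  constructor
  · intro hs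
    exact huniq _ _ _ hbase (hspec.symm.trans hs)
  · rintro rfl
    exact hspec

/-! ### The Lagrangian and the Hamiltonian sides of the extended triple -/

/-- `dL : J^1π → T^*(J^1π)`. The derivative of `L` along `J^1π` is only determined on vectors
tangent to `J^1π`, to which it is restricted. -/
def lagrangianDifferential (π : M → ℝ) (L : TangentBundle 𝓘(ℝ, E) M → ℝ)
    (v : jetSpace 𝓘(ℝ, E) π) : JetCotangent 𝓘(ℝ, E) π :=
  ⟨v, ContinuousLinearMap.comp
    (show TangentSpace (𝓘(ℝ, E)).tangent v.1 →L[ℝ] ℝ from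
      mfderivWithin (𝓘(ℝ, E)).tangent 𝓘(ℝ, ℝ) L (jetSpace 𝓘(ℝ, E) π) v.1)
    (Submodule.subtypeL _)⟩

theorem tangentMap_cotProj_mem {π : M → ℝ} (hπ : IsFibration 𝓘(ℝ, E) π)
    {z : TangentBundle (cotModel E) (CotangentBundle 𝓘(ℝ, E) M)}
    (hz : z ∈ jetSpace (cotModel E) (cotTime (E := E) π)) :
    tangentMap (cotModel E) 𝓘(ℝ, E) (cotProj M) z ∈ jetSpace 𝓘(ℝ, E) π := by
  have h1 : MDifferentiableAt (cotModel E) 𝓘(ℝ, E) (cotProj (E := E) M) z.1 :=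
    (Bundle.contMDiff_proj (n := 1) _).mdifferentiable (by norm_num) z.1
  have h2 : MDifferentiableAt 𝓘(ℝ, E) 𝓘(ℝ, ℝ) π (cotProj M z.1) :=
    hπ.smooth.mdifferentiable (by simp) _
  have h3 := mfderiv_comp z.1 h2 h1
  have h4 : mfderiv (cotModel E) 𝓘(ℝ, ℝ) (π ∘ cotProj (E := E) M) z.1 z.2 = (1 : ℝ) := hz
  rw [h3] at h4
  exact h4

/-- The 1-jet prolongation `j^1π_M : J^1π̃_M → J^1π` of `π_M : T^*M → M`. -/
def jetProj {π : M → ℝ} (hπ : IsFibration 𝓘(ℝ, E) π)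
    (z : jetSpace (cotModel E) (cotTime (E := E) π)) : jetSpace 𝓘(ℝ, E) π :=
  ⟨tangentMap (cotModel E) 𝓘(ℝ, E) (cotProj M) z.1, tangentMap_cotProj_mem hπ z.2⟩

/-- The canonical Tulczyjew fibration `Ã_π : J^1π̃_M → T^*(J^1π)`: `Ã_π(z)` is the restriction
of `A_M(z)` to the tangent space of `J^1π` at `j^1π_M(z)`. -/
def tulczyjewFibration {π : M → ℝ} (hπ : IsFibration 𝓘(ℝ, E) π)
    (z : jetSpace (cotModel E) (cotTime (E := E) π)) : JetCotangent 𝓘(ℝ, E) π :=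
  ⟨jetProj hπ z, ContinuousLinearMap.comp
    (show TangentSpace (𝓘(ℝ, E)).tangent (jetProj hπ z).1 →L[ℝ] ℝ from (tulczyjew z.1).2)
    (Submodule.subtypeL _)⟩

/-- `b̃_π : J^1π̃_M → T^*(T^*M)`, the restriction of `b_M` to `J^1π̃_M`. -/
def flatFibration (π : M → ℝ) (z : jetSpace (cotModel E) (cotTime (E := E) π)) :
    CotangentBundle (cotModel E) (CotangentBundle 𝓘(ℝ, E) M) :=
  flatMap z.1

/-- `S̃_L = Ã_π⁻¹(dL(J^1π))`. -/
def lagrangianSet {π : M → ℝ} (hπ : IsFibration 𝓘(ℝ, E) π)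
    (L : TangentBundle 𝓘(ℝ, E) M → ℝ) : Set (jetSpace (cotModel E) (cotTime (E := E) π)) :=
  tulczyjewFibration hπ ⁻¹' Set.range (lagrangianDifferential π L)

/-- `S̃_h = b̃_π⁻¹(dF_h(T^*M))`. -/
def hamiltonianSet (π : M → ℝ) (h : VerticalDual (E := E) π → CotangentBundle 𝓘(ℝ, E) M) :
    Set (jetSpace (cotModel E) (cotTime (E := E) π)) :=
  flatFibration π ⁻¹' Set.range (fun α : CotangentBundle 𝓘(ℝ, E) M =>
    (⟨α, differential (cotModel E) (sectionFunction π h) α⟩ :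
      CotangentBundle (cotModel E) (CotangentBundle 𝓘(ℝ, E) M)))

/-- `S` is a Lagrangian submanifold of the presymplectic manifold `J^1π̃_M`, with presymplectic
form the pull-back of `Ω_M^c` under the inclusion into `T(T^*M)`. -/
def IsLagrangianInJet (π : M → ℝ) (S : Set (jetSpace (cotModel E) (cotTime (E := E) π))) :
    Prop :=
  IsLagrangianSubmanifold (cotModel E).tangent
    (jetSpace (cotModel E) (cotTime (E := E) π))
    (jetTangent (cotModel E) (cotTime (E := E) π)) completeLift S

end Mechanics

end TimeDependentMechanics

end

/-!
Both sets turn out to be the image of one Hamiltonian vector field. Write `G = leg_L⁻¹ ∘ μ`, a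
smooth map `T^*M → J^1π` over `M`, and `F = F_h`.

*The set `S̃_h`.* Evaluating `α = Leg_L(G α) + F(α) η` on `G α` gives `F(α) = α(G α) - L(G α)`
(`sectionFunction_eq`), so `F` is smooth. As `Ω_M` is nondegenerate, `S̃_h` is contained in the
image of the Hamiltonian vector field `X_F : T^*M → T(T^*M)`. Since `∂F/∂p = G` and `G` takes values in
`J^1π`, the field `X_F` takes values in `J^1π̃_M`, and its image is exactly `S̃_h`.

*`S̃_h` is Lagrangian.* The coordinate changes of `T^*M` are cotangent lifts, hence symplectic
(`darboux_fderiv_of_cotangentLift`); so in every chart `X_F` is the map `y ↦ (y, ♯ DF(y))`, where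
`♯` is the inverse of `ξ ↦ Ω(ξ, ·)`. This makes `X_F` smooth, and an embedding because it is a section.
Its tangent spaces are the graphs of `♯ ∘ D²F`, which are isotropic for the complete lift `Ω_M^c`
because `D²F` is symmetric. They have half the dimension of `T(T^*M)`, that is, they are Lagrangian
subspaces of a symplectic vector space contained in the tangent space `W` of `J^1π̃_M`. For any such
subspace `C ⊆ W` one has `W^⊥ ⊆ C^⊥ = C`, so the kernel of the restricted form is `W^⊥` and lies in
`C`; the dimension formula follows (`two_mul_finrank_eq_of_isLagrangian`).

*Equality.* Work in the chart at the base point `q` of a jet `v = (q, w)`; let `T` be `π` in this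
chart and `D` the derivative of `L` along `J^1π = {dT(q) w = 1}` at `v`. For `G(α) = v`, and `p` the
components of `α`, the definition of `Leg_L` reads `p(u) = (L + F) dT(u) + D(0, u - dT(u) w)`.
Differentiating `F = p(G) - L(q, G)` along with the constraint `dT(q) G = 1` then gives
`dF(δq, δp) = δp(w) - (L + F) D²T(δq, w) - D(δq, - D²T(δq, w) w)` (`differential_energy`).
With these two formulas, the equations `q̇ = ∂F/∂p`, `ṗ = - ∂F/∂q` of `S̃_h` and the equation
`ṗ(δq) + p(δw) = D(δq, δw)` on `T_v J^1π` of `S̃_L` are equivalent by linear algebra.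
-/

noncomputable section

namespace TimeDependentMechanics

open Filter Topology

/-! ### Lagrangian subspaces -/

section LinearAlgebra

variable {V : Type*} [AddCommGroup V] [Module ℝ V] [TopologicalSpace V]
  [FiniteDimensional ℝ V]

/-- A Lagrangian subspace `C` of a symplectic vector space `(V, σ)` satisfies the dimension formula
for Lagrangian subspaces of the presymplectic space `(W, σ|_W)`, for every subspace `W ⊇ C`:
the kernel of `σ|_W` is `W^⊥`, and `W^⊥ ⊆ C^⊥ = C`. Here `flat` is the flat map of `σ|_W`. -/
theorem two_mul_finrank_eq_of_isLagrangian (σ : V →L[ℝ] V →L[ℝ] ℝ)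
    (hskew : ∀ a b, σ a b = -σ b a) (hnd : ∀ a, (∀ b, σ a b = 0) → a = 0)
    {C W : Submodule ℝ V} (hCW : C ≤ W) (hC : ∀ a ∈ C, ∀ b ∈ C, σ a b = 0)
    (hdim : 2 * Module.finrank ℝ C = Module.finrank ℝ V)
    (flat : W →ₗ[ℝ] (W →L[ℝ] ℝ)) (hflat : ∀ a b : W, flat a b = σ a b) :
    2 * Module.finrank ℝ C = Module.finrank ℝ (LinearMap.range flat) +
      2 * Module.finrank ℝ ↥(C ⊓ (LinearMap.ker flat).map W.subtype) := by
  let B : LinearMap.BilinForm ℝ V :=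
    LinearMap.mk₂ ℝ (fun a b => σ a b) (by simp) (by simp) (by simp) (by simp)
  have hB : ∀ a b, B a b = σ a b := fun _ _ => rfl
  have hrefl : B.IsRefl := fun a b h => by rw [hB] at h ⊢; rw [hskew, h, neg_zero]
  have hBnd : B.Nondegenerate :=
    ⟨fun a h => hnd a h, fun a h => hnd a fun b => by rw [hskew, ← hB, h b, neg_zero]⟩
  have horth : ∀ U : Submodule ℝ V, Module.finrank ℝ (B.orthogonal U) =
      Module.finrank ℝ V - Module.finrank ℝ U := fun U =>
    LinearMap.BilinForm.finrank_orthogonal hBnd U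
  have hCC : B.orthogonal C = C := by
    have hle : C ≤ B.orthogonal C := fun a ha b hb => hC b hb a ha
    refine (Submodule.eq_of_le_of_finrank_eq hle ?_).symm
    rw [horth]; omega
  have hWC : B.orthogonal W ≤ C := hCC ▸ LinearMap.BilinForm.orthogonal_le hCW
  have hK : (LinearMap.ker flat).map W.subtype = B.orthogonal W := by
    ext a
    constructor
    · rintro ⟨a, ha, rfl⟩ b hb
      have h := DFunLike.congr_fun (LinearMap.mem_ker.1 ha) ⟨b, hb⟩
      rw [hflat] at h
      exact (hskew _ _).trans (by rw [Submodule.subtype_apply, h]; simp)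
    · intro ha
      refine ⟨⟨a, hCW (hWC ha)⟩, LinearMap.mem_ker.2 ?_, rfl⟩
      ext b
      rw [hflat, hskew]
      exact neg_eq_zero.2 (ha b b.2)
  have h1 := LinearMap.finrank_range_add_finrank_ker flat
  have h2 : Module.finrank ℝ ((LinearMap.ker flat).map W.subtype) =
      Module.finrank ℝ (LinearMap.ker flat) :=
    (Submodule.equivMapOfInjective _ W.injective_subtype _).finrank_eq.symm
  rw [inf_eq_right.2 (hK ▸ hWC), h2]
  have h3 := horth W
  rw [← hK, h2] at h3
  have h4 := Submodule.finrank_le W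
  omega

end LinearAlgebra

/-! ### Calculus in cotangent coordinates -/

section Calculus

variable {E : Type*} [NormedAddCommGroup E] [NormedSpace ℝ E]

/-- Cotangent lifts are symplectic: `Φ(q, p) = (τ(q), P)` with `P ∘ Dτ(q) = p` preserves
`dq^i ∧ dp_i`. The inverse of `Dτ` is never formed; one differentiates the identity
`P(Dτ(q) w) = p(w)` and uses the symmetry of `D²τ`. -/
theorem darboux_fderiv_of_cotangentLift {Φ : E × (E →L[ℝ] ℝ) → E × (E →L[ℝ] ℝ)} {τ : E → E}
    {y : E × (E →L[ℝ] ℝ)} (hΦ : DifferentiableAt ℝ Φ y) (hτ : ContDiffAt ℝ 2 τ y.1)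
    (hfst : ∀ᶠ y' in 𝓝 y, (Φ y').1 = τ y'.1)
    (hsnd : ∀ᶠ y' in 𝓝 y, ∀ w, (Φ y').2 (fderiv ℝ τ y'.1 w) = y'.2 w)
    (a b : E × (E →L[ℝ] ℝ)) :
    darboux E (fderiv ℝ Φ y a) (fderiv ℝ Φ y b) = darboux E a b := by
  have hτ1 : DifferentiableAt ℝ τ y.1 := hτ.differentiableAt (by norm_num)
  have hτ2 : DifferentiableAt ℝ (fderiv ℝ τ) y.1 :=
    (hτ.fderiv_right (m := 1) (by norm_num)).differentiableAt (by norm_num)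
  have hK1 : ∀ c, (fderiv ℝ Φ y c).1 = fderiv ℝ τ y.1 c.1 := by
    intro c
    have h1 : HasFDerivAt (fun y' => (Φ y').1)
        ((ContinuousLinearMap.fst ℝ E (E →L[ℝ] ℝ)).comp (fderiv ℝ Φ y)) y :=
      hasFDerivAt_fst.comp y hΦ.hasFDerivAt
    have h2 : HasFDerivAt (fun y' : E × (E →L[ℝ] ℝ) => τ y'.1)
        ((fderiv ℝ τ y.1).comp (ContinuousLinearMap.fst ℝ E (E →L[ℝ] ℝ))) y :=
      hτ1.hasFDerivAt.comp y hasFDerivAt_fst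
    exact DFunLike.congr_fun (h1.unique (h2.congr_of_eventuallyEq hfst)) c
  have hK2 : ∀ c w, (fderiv ℝ Φ y c).2 (fderiv ℝ τ y.1 w) +
      (Φ y).2 (fderiv ℝ (fderiv ℝ τ) y.1 c.1 w) = c.2 w := by
    intro c w
    have h1 : HasFDerivAt (fun y' => (Φ y').2)
        ((ContinuousLinearMap.snd ℝ E (E →L[ℝ] ℝ)).comp (fderiv ℝ Φ y)) y :=
      hasFDerivAt_snd.comp y hΦ.hasFDerivAt
    have h2 : HasFDerivAt (fun y' : E × (E →L[ℝ] ℝ) => fderiv ℝ τ y'.1)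
        ((fderiv ℝ (fderiv ℝ τ) y.1).comp (ContinuousLinearMap.fst ℝ E (E →L[ℝ] ℝ))) y :=
      hτ2.hasFDerivAt.comp y hasFDerivAt_fst
    have h3 := h1.clm_apply (h2.clm_apply (hasFDerivAt_const w y))
    have h4 : HasFDerivAt (fun y' : E × (E →L[ℝ] ℝ) => y'.2) _ y := hasFDerivAt_snd (𝕜 := ℝ)
    have h5 := h4.clm_apply (hasFDerivAt_const w y)
    have h6 := DFunLike.congr_fun (h3.unique (h5.congr_of_eventuallyEq
      (hsnd.mono fun y' h => h w))) c
    simpa [add_comm] using h6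
  have hsymm := (hτ.isSymmSndFDerivAt (by simp)) a.1 b.1
  have ha := hK2 a b.1
  have hb := hK2 b a.1
  rw [darboux_apply, darboux_apply, hK1, hK1, ← ha, ← hb, hsymm]
  ring

theorem darboux_skew (a b : E × (E →L[ℝ] ℝ)) : darboux E a b = -darboux E b a := by
  rw [darboux_apply, darboux_apply]; ring

theorem darboux_nondegenerate {a : E × (E →L[ℝ] ℝ)} (h : ∀ b, darboux E a b = 0) : a = 0 := by
  refine Prod.ext ?_ ?_
  · refine SeparatingDual.eq_zero_of_forall_dual_eq_zero (R := ℝ) (x := a.1) fun p => ?_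
    simpa [darboux_apply] using h (0, p)
  · ext w
    simpa [darboux_apply] using h (w, 0)

/-- The isomorphism `a ↦ σ(a, ·)` of a finite-dimensional space with its dual given by a
nondegenerate bilinear form. -/
def flatEquiv {V : Type*} [NormedAddCommGroup V] [NormedSpace ℝ V] [FiniteDimensional ℝ V]
    (σ : V →L[ℝ] V →L[ℝ] ℝ) (hσ : ∀ a, (∀ b, σ a b = 0) → a = 0) : V ≃L[ℝ] (V →L[ℝ] ℝ) :=
  have hfin : Module.finrank ℝ V = Module.finrank ℝ (V →L[ℝ] ℝ) :=
    Subspace.dual_finrank_eq.symm.trans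
      (LinearMap.toContinuousLinearMap (𝕜 := ℝ) (E := V) (F' := ℝ)).finrank_eq
  have hinj : Function.Injective σ :=
    (injective_iff_map_eq_zero σ).2 fun a h => hσ a (DFunLike.congr_fun h)
  have : FiniteDimensional ℝ (V →L[ℝ] ℝ) :=
    (LinearMap.toContinuousLinearMap (𝕜 := ℝ) (E := V) (F' := ℝ)).finiteDimensional
  ContinuousLinearEquiv.ofBijective σ (LinearMap.ker_eq_bot.2 hinj)
    (LinearMap.range_eq_top.2
      ((LinearMap.injective_iff_surjective_of_finrank_eq_finrank hfin).1 hinj))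

/-- The isomorphism `ξ ↦ Ω(ξ, ·)` of `E × E^*` with its dual, where `Ω = dq^i ∧ dp_i`. -/
def darbouxEquiv (E : Type*) [NormedAddCommGroup E] [NormedSpace ℝ E] [FiniteDimensional ℝ E] :
    (E × (E →L[ℝ] ℝ)) ≃L[ℝ] ((E × (E →L[ℝ] ℝ)) →L[ℝ] ℝ) :=
  flatEquiv (darboux E) fun _ => darboux_nondegenerate

theorem darboux_darbouxEquiv_symm [FiniteDimensional ℝ E] (l : (E × (E →L[ℝ] ℝ)) →L[ℝ] ℝ) :
    darboux E ((darbouxEquiv E).symm l) = l := (darbouxEquiv E).apply_symm_apply l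

section Legendre

variable {T : E → ℝ} {l : E × E → ℝ} {J : Set (E × E)} {q₀ w₀ : E}

/-- The derivative at `0` of `X ↦ l(q₀, w₀ + (X - dT(X) w₀))`, the function whose derivative enters
the extended Legendre transformation. The function `l` is only known on `J = {dT(q) w = 1}`, which
contains all the points at which it is evaluated. -/
theorem hasFDerivAt_fibre
    (hJ : ∀ᶠ y in 𝓝 (q₀, w₀), y ∈ J ↔ fderiv ℝ T y.1 y.2 = 1)
    (hl : DifferentiableWithinAt ℝ l J (q₀, w₀)) (h₀ : fderiv ℝ T q₀ w₀ = 1) :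
    HasFDerivAt (fun X : E => l (q₀, w₀ + (X - fderiv ℝ T q₀ X • w₀)))
      ((fderivWithin ℝ l J (q₀, w₀)).comp ((ContinuousLinearMap.inr ℝ E E).comp
        (ContinuousLinearMap.id ℝ E - (fderiv ℝ T q₀).smulRight w₀))) 0 := by
  let A : E →L[ℝ] E := ContinuousLinearMap.id ℝ E - (fderiv ℝ T q₀).smulRight w₀
  have hg : HasFDerivAt (fun X : E => (q₀, w₀ + A X)) ((ContinuousLinearMap.inr ℝ E E).comp A) 0 :=
    (hasFDerivAt_const q₀ 0).prodMk (A.hasFDerivAt.const_add w₀)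
  have h0 : (q₀, w₀ + A 0) = (q₀, w₀) := by simp
  have hmem : ∀ᶠ X in 𝓝 (0 : E), (q₀, w₀ + A X) ∈ J := by
    have := hg.continuousAt
    rw [ContinuousAt, h0] at this
    filter_upwards [this.eventually hJ] with X hX
    rw [hX]
    simp [A, h₀]
  have hl' : HasFDerivWithinAt l (fderivWithin ℝ l J (q₀, w₀)) J (q₀, w₀ + A 0) := by
    rw [h0]; exact hl.hasFDerivWithinAt
  exact HasFDerivWithinAt.comp_hasFDerivAt 0 hl' hg hmem

/-- The derivative of the energy function `(q, p) ↦ p(g(q, p)) - l(q, g(q, p))`, where the jets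
`(q, g(q, p))` satisfy the constraint `dT(q) g = 1` and `p₀` is the Legendre transform of `(q₀, w₀)`
up to a multiple of `dT`. The derivative of `g` does not contribute, apart from its component along
`w₀`, which the constraint determines. -/
theorem fderiv_energy {g : E × (E →L[ℝ] ℝ) → E} {p₀ : E →L[ℝ] ℝ} {F₀ : ℝ}
    (hJ : ∀ᶠ y in 𝓝 (q₀, w₀), y ∈ J ↔ fderiv ℝ T y.1 y.2 = 1)
    (hl : DifferentiableWithinAt ℝ l J (q₀, w₀))
    (hT : DifferentiableAt ℝ (fderiv ℝ T) q₀)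
    (hg : DifferentiableAt ℝ g (q₀, p₀)) (hg₀ : g (q₀, p₀) = w₀)
    (hgJ : ∀ᶠ y in 𝓝 (q₀, p₀), (y.1, g y) ∈ J)
    (hp₀ : ∀ w, p₀ w = F₀ * fderiv ℝ T q₀ w +
      fderivWithin ℝ l J (q₀, w₀) (0, w - fderiv ℝ T q₀ w • w₀))
    (δq : E) (δp : E →L[ℝ] ℝ) :
    fderiv ℝ (fun y => y.2 (g y) - l (y.1, g y)) (q₀, p₀) (δq, δp) =
      δp w₀ - (F₀ * fderiv ℝ (fderiv ℝ T) q₀ δq w₀ +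
        fderivWithin ℝ l J (q₀, w₀) (δq, -(fderiv ℝ (fderiv ℝ T) q₀ δq w₀ • w₀))) := by
  set Dg := fderiv ℝ g (q₀, p₀)
  set y₀ : E × (E →L[ℝ] ℝ) := (q₀, p₀)
  have hgd : HasFDerivAt g Dg y₀ := hg.hasFDerivAt
  have h1 : HasFDerivAt (fun y : E × (E →L[ℝ] ℝ) => (y.1, g y))
      ((ContinuousLinearMap.fst ℝ E (E →L[ℝ] ℝ)).prod Dg) y₀ := hasFDerivAt_fst.prodMk hgd
  have hev : ∀ᶠ y in 𝓝 y₀, fderiv ℝ T y.1 (g y) = 1 := by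
    have hc := h1.continuousAt
    rw [ContinuousAt, hg₀] at hc
    filter_upwards [hc.eventually hJ, hgJ] with y h h' using h.1 h'
  have h2 : HasFDerivAt (fun y : E × (E →L[ℝ] ℝ) => fderiv ℝ T y.1)
      ((fderiv ℝ (fderiv ℝ T) q₀).comp (ContinuousLinearMap.fst ℝ E (E →L[ℝ] ℝ))) y₀ :=
    HasFDerivAt.comp y₀ (f := Prod.fst) hT.hasFDerivAt hasFDerivAt_fst
  -- differentiate the constraint `dT(q) g(q, p) = 1`
  have h3 : fderiv ℝ T q₀ (Dg (δq, δp)) = -fderiv ℝ (fderiv ℝ T) q₀ δq w₀ := by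
    have h := DFunLike.congr_fun ((h2.clm_apply hgd).unique
      ((hasFDerivAt_const (1 : ℝ) y₀).congr_of_eventuallyEq hev)) (δq, δp)
    simp [hg₀, y₀] at h
    linarith
  have hl' : HasFDerivWithinAt l (fderivWithin ℝ l J (q₀, w₀)) J (y₀.1, g y₀) := by
    rw [hg₀]; exact hl.hasFDerivWithinAt
  have h4 := HasFDerivWithinAt.comp_hasFDerivAt y₀ hl' h1 hgJ
  have h5 : HasFDerivAt (fun y : E × (E →L[ℝ] ℝ) => y.2) _ y₀ := hasFDerivAt_snd (𝕜 := ℝ)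
  have h9 : HasFDerivAt (fun y : E × (E →L[ℝ] ℝ) => y.2 (g y) - l (y.1, g y)) _ y₀ :=
    (h5.clm_apply hgd).sub h4
  rw [h9.fderiv]
  have h6 := hp₀ (Dg (δq, δp))
  -- split `(δq, Dg)` into a vertical vector tangent to `J` and a multiple of `w₀`
  have h7 : ((δq, Dg (δq, δp)) : E × E) =
      (0, Dg (δq, δp) - fderiv ℝ T q₀ (Dg (δq, δp)) • w₀) +
        (δq, -(fderiv ℝ (fderiv ℝ T) q₀ δq w₀ • w₀)) := by
    rw [h3]; simp
  change p₀ (Dg (δq, δp)) + δp (g y₀) - fderivWithin ℝ l J (q₀, w₀) (δq, Dg (δq, δp)) = _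
  rw [h7, map_add, h6, hg₀, h3]
  ring

end Legendre

end Calculus

/-! ### Preferred charts and tangent coordinate changes -/

section Coordinates

variable {E : Type*} [NormedAddCommGroup E] [NormedSpace ℝ E]
  {H : Type*} [TopologicalSpace H] {I : ModelWithCorners ℝ E H}
  {N : Type*} [TopologicalSpace N] [ChartedSpace H N] [IsManifold I 1 N]

theorem hasFDerivAt_tangentCoordChange [I.Boundaryless] {x y z : N}
    (hx : z ∈ (extChartAt I x).source) (hy : z ∈ (extChartAt I y).source) :
    HasFDerivAt (extChartAt I y ∘ (extChartAt I x).symm) (tangentCoordChange I x y z)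
      (extChartAt I x z) := by
  have := hasFDerivWithinAt_tangentCoordChange (I := I) ⟨hx, hy⟩
  rwa [I.range_eq_univ, hasFDerivWithinAt_univ] at this

/-- The differential of `τ` at `y`, read in the chart at `x`, is the derivative of the local
representative of `τ` in that chart. -/
theorem differential_tangentCoordChange [I.Boundaryless] {τ : N → ℝ} {x y : N}
    (hy : y ∈ (extChartAt I x).source) (hτ : MDifferentiableAt I 𝓘(ℝ, ℝ) τ y) (w : E) :
    differential I τ y (tangentCoordChange I x y y w) =
      fderiv ℝ (τ ∘ (extChartAt I x).symm) (extChartAt I x y) w := by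
  have h1 : HasFDerivAt (τ ∘ (extChartAt I y).symm) (differential I τ y) (extChartAt I y y) := by
    let D : E →L[ℝ] ℝ := differential I τ y
    have h : HasFDerivWithinAt (τ ∘ (extChartAt I y).symm) D
      (Set.range I) (extChartAt I y y) := hτ.hasMFDerivAt.2
    rwa [I.range_eq_univ, hasFDerivWithinAt_univ] at h
  have h2 := hasFDerivAt_tangentCoordChange (I := I) hy (mem_extChartAt_source (I := I) y)
  have h0 : (extChartAt I y ∘ (extChartAt I x).symm) (extChartAt I x y) = extChartAt I y y := by
    rw [Function.comp_apply, (extChartAt I x).left_inv hy]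
  rw [← h0] at h1
  have h3 := h1.comp _ h2
  have h4 : τ ∘ (extChartAt I x).symm =ᶠ[𝓝 (extChartAt I x y)]
      (τ ∘ (extChartAt I y).symm) ∘ (extChartAt I y ∘ (extChartAt I x).symm) := by
    have hc : ContinuousAt (extChartAt I x).symm (extChartAt I x y) :=
      continuousAt_extChartAt_symm' hy
    have := hc.eventually_mem (s := (extChartAt I y).source) (by
      rw [(extChartAt I x).left_inv hy]; exact extChartAt_source_mem_nhds y)
    filter_upwards [this] with q hq
    simp only [Function.comp_apply]
    rw [(extChartAt I y).left_inv hq]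
  exact (DFunLike.congr_fun (h3.congr_of_eventuallyEq h4).fderiv w).symm

theorem extChartAt_tangentBundle_apply (v w : TangentBundle I N) :
    extChartAt I.tangent v w = (extChartAt I v.1 w.1, tangentCoordChange I w.1 v.1 w.1 w.2) := rfl

end Coordinates

/-! ### The cotangent bundle in charts -/

universe u

section Mechanics

variable {E : Type*} [NormedAddCommGroup E] [NormedSpace ℝ E]
  {M : Type*} [TopologicalSpace M] [ChartedSpace E M] [IsManifold 𝓘(ℝ, E) ∞ M]

theorem extChartAt_cotangentBundle_fst (α β : CotangentBundle 𝓘(ℝ, E) M) :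
    (extChartAt (cotModel E) α β).1 = extChartAt 𝓘(ℝ, E) α.1 β.1 := rfl

/-- The momentum components of a covector in the preferred chart at its base point. -/
def momentum (α : CotangentBundle 𝓘(ℝ, E) M) : E →L[ℝ] ℝ := α.2

theorem mem_extChartAt_cotangentBundle_source {α β : CotangentBundle 𝓘(ℝ, E) M} :
    β ∈ (extChartAt (cotModel E) α).source ↔ β.1 ∈ (extChartAt 𝓘(ℝ, E) α.1).source := by
  rw [extChartAt_source, extChartAt_source, FiberBundle.chartedSpace_chartAt]
  simp only [mfld_simps]
  exact ⟨fun h => h.1.1, fun h => ⟨⟨h, trivial⟩, h⟩⟩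

theorem extChartAt_cotangentBundle_snd {α β : CotangentBundle 𝓘(ℝ, E) M}
    (h : β.1 ∈ (extChartAt 𝓘(ℝ, E) α.1).source) (w : E) :
    (extChartAt (cotModel E) α β).2 w = momentum β (tangentCoordChange 𝓘(ℝ, E) α.1 β.1 β.1 w) := by
  rw [extChartAt_source] at h
  have h1 := TangentBundle.symmL_trivializationAt_eq_core (I := 𝓘(ℝ, E)) h
  have h2 : (extChartAt (cotModel E) α β).2 w = β.2
    ((trivializationAt E (TangentSpace 𝓘(ℝ, E)) α.1).symmL ℝ β.1 w) := by
    change (Bundle.Trivialization.continuousLinearMapAt ℝ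
      (Bundle.Trivial.trivialization M ℝ) β.1) _ = _
    rw [Bundle.Trivial.continuousLinearMapAt_trivialization]
    rfl
  rw [h2, h1]
  rfl

/-- Coordinate changes between the preferred charts of `T^*M` are symplectic, so that the
canonical symplectic form may be computed in any of these charts. -/
theorem darboux_tangentCoordChange {α β : CotangentBundle 𝓘(ℝ, E) M}
    (h : β.1 ∈ (extChartAt 𝓘(ℝ, E) α.1).source) (a b : E × (E →L[ℝ] ℝ)) :
    darboux E (tangentCoordChange (cotModel E) β α β a) (tangentCoordChange (cotModel E) β α β b) =
      darboux E a b := by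
  have hβ : β ∈ (extChartAt (cotModel E) β).source := mem_extChartAt_source β
  have hα : β ∈ (extChartAt (cotModel E) α).source := mem_extChartAt_cotangentBundle_source.2 h
  have hΦ := hasFDerivAt_tangentCoordChange hβ hα
  rw [← hΦ.fderiv]
  have hτ : ContDiffAt ℝ ∞ (extChartAt 𝓘(ℝ, E) α.1 ∘ (extChartAt 𝓘(ℝ, E) β.1).symm)
      (extChartAt 𝓘(ℝ, E) β.1 β.1) := by
    have := contDiffWithinAt_ext_coord_change (I := 𝓘(ℝ, E)) (n := ∞) α.1 β.1
      (y := extChartAt 𝓘(ℝ, E) β.1 β.1) (by simpa using h)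
    rwa [ModelWithCorners.range_eq_univ, contDiffWithinAt_univ] at this
  have htarget := extChartAt_target_mem_nhds (I := cotModel E) β
  have hsource : ∀ᶠ y in 𝓝 (extChartAt (cotModel E) β β),
      (extChartAt (cotModel E) β).symm y ∈ (extChartAt (cotModel E) α).source := by
    refine (continuousAt_extChartAt_symm' hβ).eventually_mem ?_
    rw [(extChartAt (cotModel E) β).left_inv hβ]
    exact extChartAt_source_mem_nhds' hα
  refine darboux_fderiv_of_cotangentLift hΦ.differentiableAt (hτ.of_le (by norm_cast))
    (Eventually.of_forall fun y => rfl) ?_ a b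
  filter_upwards [htarget, hsource] with y hy hyα w
  set γ := (extChartAt (cotModel E) β).symm y with hγ
  have hyγ : extChartAt (cotModel E) β γ = y := (extChartAt (cotModel E) β).right_inv hy
  have hγα := mem_extChartAt_cotangentBundle_source.1 hyα
  have hγβ : γ.1 ∈ (extChartAt 𝓘(ℝ, E) β.1).source :=
    mem_extChartAt_cotangentBundle_source.1 ((extChartAt (cotModel E) β).map_target hy)
  have hD := (hasFDerivAt_tangentCoordChange hγβ hγα).fderiv
  rw [← extChartAt_cotangentBundle_fst, hyγ] at hD
  rw [hD, Function.comp_apply, ← hγ, extChartAt_cotangentBundle_snd hγα,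
    tangentCoordChange_comp ⟨⟨hγβ, hγα⟩, mem_extChartAt_source _⟩,
    ← extChartAt_cotangentBundle_snd hγβ, hyγ]

theorem mfderiv_cotProj (α : CotangentBundle 𝓘(ℝ, E) M) :
    mfderiv (cotModel E) 𝓘(ℝ, E) (cotProj M) α = ContinuousLinearMap.fst ℝ E (E →L[ℝ] ℝ) := by
  have hc : ContinuousAt (cotProj (E := E) M) α :=
    (Bundle.contMDiff_proj (n := 1) (IB := 𝓘(ℝ, E)) _).continuous.continuousAt
  have h : HasFDerivAt (writtenInExtChartAt (cotModel E) 𝓘(ℝ, E) α (cotProj M))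
      (ContinuousLinearMap.fst ℝ E (E →L[ℝ] ℝ)) (extChartAt (cotModel E) α α) := by
    refine hasFDerivAt_fst.congr_of_eventuallyEq ?_
    filter_upwards [extChartAt_target_mem_nhds (I := cotModel E) α] with y hy
    exact congrArg Prod.fst ((extChartAt (cotModel E) α).right_inv hy)
  exact HasMFDerivAt.mfderiv ⟨hc, h.hasFDerivWithinAt⟩

theorem tangentMap_cotProj (z : TangentBundle (cotModel E) (CotangentBundle 𝓘(ℝ, E) M)) :
    tangentMap (cotModel E) 𝓘(ℝ, E) (cotProj M) z =
      ⟨z.1.1, (show E × (E →L[ℝ] ℝ) from z.2).1⟩ := by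
  rw [tangentMap, mfderiv_cotProj]; rfl

theorem completeLift_apply (z : TangentBundle (cotModel E) (CotangentBundle 𝓘(ℝ, E) M))
    (a b : (E × (E →L[ℝ] ℝ)) × (E × (E →L[ℝ] ℝ))) :
    completeLift z a b = darboux E a.1 b.2 + darboux E a.2 b.1 := rfl

theorem completeLift_skew (z : TangentBundle (cotModel E) (CotangentBundle 𝓘(ℝ, E) M))
    (a b : (E × (E →L[ℝ] ℝ)) × (E × (E →L[ℝ] ℝ))) :
    completeLift z a b = -completeLift z b a := by
  rw [completeLift_apply, completeLift_apply, darboux_skew, darboux_skew a.2]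
  ring

theorem completeLift_nondegenerate (z : TangentBundle (cotModel E) (CotangentBundle 𝓘(ℝ, E) M))
    {a : (E × (E →L[ℝ] ℝ)) × (E × (E →L[ℝ] ℝ))}
    (h : ∀ b : (E × (E →L[ℝ] ℝ)) × (E × (E →L[ℝ] ℝ)), completeLift z a b = 0) : a = 0 := by
  refine Prod.ext (darboux_nondegenerate fun b => ?_) (darboux_nondegenerate fun b => ?_)
  · simpa [completeLift_apply] using h (0, b)
  · simpa [completeLift_apply] using h (b, 0)

theorem contDiffAt_comp_extChartAt_symm {F : CotangentBundle 𝓘(ℝ, E) M → ℝ}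
    (hF : ContMDiff (cotModel E) 𝓘(ℝ, ℝ) ∞ F) (α : CotangentBundle 𝓘(ℝ, E) M) :
    ContDiffAt ℝ ∞ (F ∘ (extChartAt (cotModel E) α).symm) (extChartAt (cotModel E) α α) := by
  have h := (contMDiffAt_iff.1 (hF α)).2
  rwa [ModelWithCorners.range_eq_univ, contDiffWithinAt_univ] at h

/-! ### Hamiltonian vector fields -/

section HamiltonianField

variable [FiniteDimensional ℝ E]

/-- The Hamiltonian vector field of `F` on `T^*M`, characterized by `Ω_M(X, ·) = dF`, as a map
into `T(T^*M)`. -/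
def hamiltonianField (F : CotangentBundle 𝓘(ℝ, E) M → ℝ) (α : CotangentBundle 𝓘(ℝ, E) M) :
    TangentBundle (cotModel E) (CotangentBundle 𝓘(ℝ, E) M) :=
  ⟨α, (darbouxEquiv E).symm (differential (cotModel E) F α)⟩

/-- In the chart of `T^*M` at `α`, the Hamiltonian vector field of `F` is the field `♯ DF` of the
local representative of `F`. -/
theorem tangentCoordChange_hamiltonianField {F : CotangentBundle 𝓘(ℝ, E) M → ℝ}
    (hF : ContMDiff (cotModel E) 𝓘(ℝ, ℝ) ∞ F) {α β : CotangentBundle 𝓘(ℝ, E) M}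
    (h : β.1 ∈ (extChartAt 𝓘(ℝ, E) α.1).source) :
    tangentCoordChange (cotModel E) β α β (hamiltonianField F β).2 =
      (darbouxEquiv E).symm (fderiv ℝ (F ∘ (extChartAt (cotModel E) α).symm)
        (extChartAt (cotModel E) α β)) := by
  have hα : β ∈ (extChartAt (cotModel E) α).source := mem_extChartAt_cotangentBundle_source.2 h
  rw [ContinuousLinearEquiv.eq_symm_apply]
  refine ContinuousLinearMap.ext fun b => ?_
  have hb : tangentCoordChange (cotModel E) β α β (tangentCoordChange (cotModel E) α β β b) =
      b := by
    rw [tangentCoordChange_comp ⟨⟨hα, mem_extChartAt_source _⟩, hα⟩, tangentCoordChange_self hα]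
  rw [← differential_tangentCoordChange hα (hF.mdifferentiable (by simp) β)]
  conv_lhs => rw [← hb]
  refine (darboux_tangentCoordChange h _ _).trans ?_
  exact DFunLike.congr_fun (darboux_darbouxEquiv_symm _) _

theorem contMDiff_hamiltonianField {F : CotangentBundle 𝓘(ℝ, E) M → ℝ}
    (hF : ContMDiff (cotModel E) 𝓘(ℝ, ℝ) ∞ F) :
    ContMDiff (cotModel E) (cotModel E).tangent ∞ (hamiltonianField F) := by
  intro α
  refine Bundle.contMDiffAt_totalSpace.2 ⟨contMDiffAt_id, ?_⟩
  have h1 := ((contDiffAt_comp_extChartAt_symm hF α).fderiv_right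
    (m := ∞) (by simp)).continuousLinearMap_comp (darbouxEquiv E).symm.toContinuousLinearMap
  have h2 := h1.contMDiffAt.comp α (contMDiffAt_extChartAt (I := cotModel E) (n := ∞) (x := α))
  refine h2.congr_of_eventuallyEq ?_
  filter_upwards [extChartAt_source_mem_nhds (I := cotModel E) α] with β hβ
  exact tangentCoordChange_hamiltonianField hF (mem_extChartAt_cotangentBundle_source.1 hβ)

theorem hasMFDerivAt_hamiltonianField {F : CotangentBundle 𝓘(ℝ, E) M → ℝ}
    (hF : ContMDiff (cotModel E) 𝓘(ℝ, ℝ) ∞ F) (α : CotangentBundle 𝓘(ℝ, E) M) :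
    HasMFDerivAt (cotModel E) (cotModel E).tangent (hamiltonianField F) α
      ((ContinuousLinearMap.id ℝ (E × (E →L[ℝ] ℝ))).prod
        ((darbouxEquiv E).symm.toContinuousLinearMap.comp
          (fderiv ℝ (fderiv ℝ (F ∘ (extChartAt (cotModel E) α).symm))
            (extChartAt (cotModel E) α α)))) := by
  refine ⟨(contMDiff_hamiltonianField hF).continuous.continuousAt, ?_⟩
  have h1 : HasFDerivAt (fderiv ℝ (F ∘ (extChartAt (cotModel E) α).symm)) _
      (extChartAt (cotModel E) α α) :=
    (((contDiffAt_comp_extChartAt_symm hF α).fderiv_right (m := 1) (by norm_cast)).differentiableAt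
      (by norm_num)).hasFDerivAt
  have h2 := (hasFDerivAt_id (𝕜 := ℝ) (extChartAt (cotModel E) α α)).prodMk
    ((darbouxEquiv E).symm.hasFDerivAt.comp _ h1)
  refine (h2.congr_of_eventuallyEq ?_).hasFDerivWithinAt
  filter_upwards [extChartAt_target_mem_nhds (I := cotModel E) α] with y hy
  have hβ := mem_extChartAt_cotangentBundle_source.1 ((extChartAt (cotModel E) α).map_target hy)
  have h3 := tangentCoordChange_hamiltonianField hF hβ
  have h4 := (extChartAt (cotModel E) α).right_inv hy
  rw [h4] at h3
  exact Prod.ext h4 h3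

theorem isEmbedding_hamiltonianField {F : CotangentBundle 𝓘(ℝ, E) M → ℝ}
    (hF : ContMDiff (cotModel E) 𝓘(ℝ, ℝ) ∞ F) :
    Topology.IsEmbedding (hamiltonianField F) :=
  Function.LeftInverse.isEmbedding (f := Bundle.TotalSpace.proj) (fun _ => rfl)
    (FiberBundle.continuous_proj _ _) (contMDiff_hamiltonianField hF).continuous

/-- The graph of `♯ ∘ Q` is isotropic for the complete lift if the bilinear form `Q` is
symmetric. -/
theorem completeLift_graph_eq_zero (z : TangentBundle (cotModel E) (CotangentBundle 𝓘(ℝ, E) M))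
    {Q : (E × (E →L[ℝ] ℝ)) →L[ℝ] (E × (E →L[ℝ] ℝ)) →L[ℝ] ℝ} (hQ : ∀ a b, Q a b = Q b a)
    (a b : E × (E →L[ℝ] ℝ)) :
    completeLift z (a, (darbouxEquiv E).symm (Q a)) (b, (darbouxEquiv E).symm (Q b)) = 0 := by
  rw [completeLift_apply, darboux_skew, darboux_darbouxEquiv_symm, darboux_darbouxEquiv_symm, hQ]
  exact neg_add_cancel _

/-- The two conditions in the definition of a Lagrangian submanifold hold for a tangent space that
is the range of an injective isotropic map `A` from a space of half the dimension. -/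
theorem two_mul_finrank_of_graph
    {σ : ((E × (E →L[ℝ] ℝ)) × (E × (E →L[ℝ] ℝ))) →L[ℝ]
      ((E × (E →L[ℝ] ℝ)) × (E × (E →L[ℝ] ℝ))) →L[ℝ] ℝ}
    (hskew : ∀ a b, σ a b = -σ b a) (hnd : ∀ a, (∀ b, σ a b = 0) → a = 0)
    {A : (E × (E →L[ℝ] ℝ)) →L[ℝ] (E × (E →L[ℝ] ℝ)) × (E × (E →L[ℝ] ℝ))}
    (hA : Function.Injective A) (hiso : ∀ a b, σ (A a) (A b) = 0)
    {W : Submodule ℝ ((E × (E →L[ℝ] ℝ)) × (E × (E →L[ℝ] ℝ)))}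
    (hCW : LinearMap.range A.toLinearMap ≤ W)
    (flat : W →ₗ[ℝ] (W →L[ℝ] ℝ)) (hflat : ∀ a b : W, flat a b = σ a b) :
    (∀ a ∈ LinearMap.range A.toLinearMap, ∀ b ∈ LinearMap.range A.toLinearMap, σ a b = 0) ∧
      2 * Module.finrank ℝ (E × (E →L[ℝ] ℝ)) = Module.finrank ℝ (LinearMap.range flat) +
        2 * Module.finrank ℝ
          ↥(LinearMap.range A.toLinearMap ⊓ (LinearMap.ker flat).map W.subtype) := by
  have hrank : Module.finrank ℝ (LinearMap.range A.toLinearMap) =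
      Module.finrank ℝ (E × (E →L[ℝ] ℝ)) := LinearMap.finrank_range_of_inj hA
  have hiso' : ∀ a ∈ LinearMap.range A.toLinearMap, ∀ b ∈ LinearMap.range A.toLinearMap,
      σ a b = 0 := by
    rintro _ ⟨a, rfl⟩ _ ⟨b, rfl⟩
    exact hiso a b
  refine ⟨hiso', ?_⟩
  rw [← hrank]
  refine two_mul_finrank_eq_of_isLagrangian σ hskew hnd hCW hiso' ?_ flat hflat
  rw [hrank, Module.finrank_prod (R := ℝ) (M := E × (E →L[ℝ] ℝ)), two_mul]

/-- A map with values in `jetSpace τ` has its derivative in the tangent spaces of `jetSpace τ`. -/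
theorem range_le_jetTangent {E' H' N' : Type*} [NormedAddCommGroup E'] [NormedSpace ℝ E']
    [TopologicalSpace H'] {I' : ModelWithCorners ℝ E' H'} [TopologicalSpace N']
    [ChartedSpace H' N'] {F G : Type*} [NormedAddCommGroup F] [NormedSpace ℝ F]
    [TopologicalSpace G] {K : ModelWithCorners ℝ F G} {P : Type*} [TopologicalSpace P]
    [ChartedSpace G P] [IsManifold I' 1 N'] {τ : N' → ℝ} {f : P → TangentBundle I' N'} {p : P}
    (hf : MDifferentiableAt K I'.tangent f p) (hfJ : ∀ p, f p ∈ jetSpace I' τ) :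
    LinearMap.range (mfderiv K I'.tangent f p).toLinearMap ≤ jetTangent I' τ (f p) := by
  rintro _ ⟨a, rfl⟩
  set g : TangentBundle I' N' → ℝ := fun w => differential I' τ w.1 w.2
  -- where the function `dτ` on `TN` is not differentiable, `jetTangent` is the whole tangent space
  by_cases hg : MDifferentiableAt I'.tangent 𝓘(ℝ, ℝ) g (f p)
  · have h1 := mfderiv_comp p hg hf
    have h2 : g ∘ f = fun _ => 1 := funext hfJ
    rw [h2, mfderiv_const] at h1
    exact (DFunLike.congr_fun h1 a).symm
  · have h1 : differential I'.tangent g (f p) = 0 := mfderiv_zero_of_not_mdifferentiableAt hg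
    exact LinearMap.mem_ker.2 (DFunLike.congr_fun h1 _)

end HamiltonianField

end Mechanics

section Lagrangian

variable {E : Type} [NormedAddCommGroup E] [NormedSpace ℝ E] [FiniteDimensional ℝ E]
  {M : Type u} [TopologicalSpace M] [ChartedSpace E M] [IsManifold 𝓘(ℝ, E) ∞ M]

/-- The image of a Hamiltonian vector field with values in `J^1π̃_M` is Lagrangian. -/
theorem isLagrangianInJet_range_hamiltonianField {π : M → ℝ}
    {S : Set (jetSpace (cotModel E) (cotTime (E := E) π))} {F : CotangentBundle 𝓘(ℝ, E) M → ℝ}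
    (hF : ContMDiff (cotModel E) 𝓘(ℝ, ℝ) ∞ F)
    (hS : Set.range (hamiltonianField F) = Subtype.val '' S) : IsLagrangianInJet π S := by
  -- `T^*M` is modelled on `ModelProd E (E →L[ℝ] ℝ)`, which has to be read as the normed space
  -- `E × (E →L[ℝ] ℝ)`
  let _ : ChartedSpace (E × (E →L[ℝ] ℝ)) (CotangentBundle 𝓘(ℝ, E) M) :=
    (inferInstance : ChartedSpace (ModelProd E (E →L[ℝ] ℝ)) (CotangentBundle 𝓘(ℝ, E) M))
  have h0 : IsManifold 𝓘(ℝ, E × (E →L[ℝ] ℝ)) ∞ (CotangentBundle 𝓘(ℝ, E) M) := by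
    rw [modelWithCornersSelf_prod]
    exact (inferInstance : IsManifold (cotModel E) ∞ (CotangentBundle 𝓘(ℝ, E) M))
  have h1 : ContMDiff 𝓘(ℝ, E × (E →L[ℝ] ℝ)) (cotModel E).tangent ∞ (hamiltonianField F) := by
    rw [modelWithCornersSelf_prod]
    exact contMDiff_hamiltonianField hF
  let D (α : CotangentBundle 𝓘(ℝ, E) M) : (E × (E →L[ℝ] ℝ)) →L[ℝ]
      (E × (E →L[ℝ] ℝ)) × (E × (E →L[ℝ] ℝ)) := (ContinuousLinearMap.id ℝ (E × (E →L[ℝ] ℝ))).prod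
        ((darbouxEquiv E).symm.toContinuousLinearMap.comp
          (fderiv ℝ (fderiv ℝ (F ∘ (extChartAt (cotModel E) α).symm))
            (extChartAt (cotModel E) α α)))
  have h2 : ∀ α, mfderiv 𝓘(ℝ, E × (E →L[ℝ] ℝ)) (cotModel E).tangent (hamiltonianField F) α =
      D α := by
    intro α
    rw [modelWithCornersSelf_prod]
    exact (hasMFDerivAt_hamiltonianField hF α).mfderiv
  have hsymm : ∀ α a b, fderiv ℝ (fderiv ℝ (F ∘ (extChartAt (cotModel E) α).symm))
      (extChartAt (cotModel E) α α) a b = fderiv ℝ (fderiv ℝ (F ∘ (extChartAt (cotModel E) α).symm))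
      (extChartAt (cotModel E) α α) b a := fun α =>
    ((contDiffAt_comp_extChartAt_symm hF α).isSymmSndFDerivAt (by simp; norm_cast)).eq
  have hJ : ∀ α, hamiltonianField F α ∈ jetSpace (cotModel E) (cotTime (E := E) π) := by
    intro α
    obtain ⟨z, -, hz⟩ : hamiltonianField F α ∈ Subtype.val '' S := hS ▸ Set.mem_range_self α
    exact hz ▸ z.2
  have h3 : ∀ α, Function.Injective (D α) := fun α a b h => congrArg Prod.fst h
  refine ⟨E × (E →L[ℝ] ℝ), inferInstance, inferInstance, inferInstance,
    CotangentBundle 𝓘(ℝ, E) M, inferInstance, inferInstance, h0, hamiltonianField F,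
    h1, isEmbedding_hamiltonianField hF, ?_, hS, ?_⟩
  · intro α
    rw [h2]; exact h3 α
  · intro α TC flat
    have hle : TC ≤ jetTangent (cotModel E) (cotTime (E := E) π) (hamiltonianField F α) :=
      range_le_jetTangent (h1.mdifferentiable (by simp) α) hJ
    have hTC : TC = LinearMap.range (D α).toLinearMap :=
      congrArg (fun A => LinearMap.range (ContinuousLinearMap.toLinearMap A)) (h2 α)
    clear_value TC
    subst hTC
    exact two_mul_finrank_of_graph (σ := completeLift (hamiltonianField F α))
      (W := jetTangent (cotModel E) (cotTime (E := E) π) (hamiltonianField F α))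
      (completeLift_skew _) (fun _ => completeLift_nondegenerate _) (h3 α)
      (completeLift_graph_eq_zero _ (hsymm α)) hle flat fun _ _ => rfl

end Lagrangian

/-! ### The jet space in charts -/

section Jets

variable {E : Type*} [NormedAddCommGroup E] [NormedSpace ℝ E]
  {M : Type*} [TopologicalSpace M] [ChartedSpace E M]

/-- The components of a tangent vector in the preferred chart at its base point. -/
def velocity (v : TangentBundle 𝓘(ℝ, E) M) : E := v.2

/-- The function `π` in the preferred chart of `M` at `x`. -/
def chartTime (π : M → ℝ) (x : M) : E → ℝ := π ∘ (extChartAt 𝓘(ℝ, E) x).symm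

theorem contDiffAt_chartTime {π : M → ℝ} (hπ : IsFibration 𝓘(ℝ, E) π) (x : M) :
    ContDiffAt ℝ ∞ (chartTime π x) (extChartAt 𝓘(ℝ, E) x x) := by
  have h := (contMDiffAt_iff.1 (hπ.smooth x)).2
  rwa [ModelWithCorners.range_eq_univ, contDiffWithinAt_univ] at h

theorem tangentBundle_ext {v w : TangentBundle 𝓘(ℝ, E) M} (h : v.1 = w.1)
    (h' : velocity v = velocity w) : v = w := by
  obtain ⟨x, v⟩ := v
  obtain ⟨y, w⟩ := w
  obtain rfl : x = y := h
  exact congrArg (Bundle.TotalSpace.mk x) h'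

theorem eventually_fst_mem_target (v : TangentBundle 𝓘(ℝ, E) M) :
    ∀ᶠ y : E × E in 𝓝 (extChartAt 𝓘(ℝ, E) v.1 v.1, velocity v),
      y.1 ∈ (extChartAt 𝓘(ℝ, E) v.1).target :=
  continuousAt_fst.eventually_mem (extChartAt_target_mem_nhds (I := 𝓘(ℝ, E)) v.1)

variable [IsManifold 𝓘(ℝ, E) ∞ M]

/-- The Lagrangian `L` in the preferred chart of `TM` at `v`. -/
def chartLagrangian (L : TangentBundle 𝓘(ℝ, E) M → ℝ) (v : TangentBundle 𝓘(ℝ, E) M) :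
    E × E → ℝ := L ∘ (extChartAt (𝓘(ℝ, E)).tangent v).symm

/-- The jet space `J^1π` in the preferred chart of `TM` at `v`. -/
def chartJet (π : M → ℝ) (v : TangentBundle 𝓘(ℝ, E) M) : Set (E × E) :=
  (extChartAt (𝓘(ℝ, E)).tangent v).symm ⁻¹' jetSpace 𝓘(ℝ, E) π

/-- The derivative of the Lagrangian along `J^1π` at `v`, in the preferred chart of `TM`. -/
def chartLagrangianDeriv (π : M → ℝ) (L : TangentBundle 𝓘(ℝ, E) M → ℝ)
    (v : TangentBundle 𝓘(ℝ, E) M) : E × E →L[ℝ] ℝ :=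
  fderivWithin ℝ (chartLagrangian L v) (chartJet π v) (extChartAt 𝓘(ℝ, E) v.1 v.1, velocity v)

theorem extChartAt_tangentBundle_self (v : TangentBundle 𝓘(ℝ, E) M) :
    extChartAt (𝓘(ℝ, E)).tangent v v = (extChartAt 𝓘(ℝ, E) v.1 v.1, velocity v) := by
  rw [extChartAt_tangentBundle_apply]
  exact Prod.ext rfl (tangentCoordChange_self (mem_extChartAt_source _))

theorem mem_extChartAt_tangentBundle_source {v w : TangentBundle 𝓘(ℝ, E) M} :
    w ∈ (extChartAt (𝓘(ℝ, E)).tangent v).source ↔ w.1 ∈ (extChartAt 𝓘(ℝ, E) v.1).source := by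
  rw [extChartAt_source, extChartAt_source, TangentBundle.mem_chart_source_iff]

theorem differential_eq_fderiv {π : M → ℝ} (hπ : IsFibration 𝓘(ℝ, E) π) (x : M) (w : E) :
    differential 𝓘(ℝ, E) π x w =
      fderiv ℝ (chartTime π x) (extChartAt 𝓘(ℝ, E) x x) w := by
  have h := mem_extChartAt_source (I := 𝓘(ℝ, E)) x
  have h1 := differential_tangentCoordChange h (hπ.smooth.mdifferentiable (by simp) x) w
  rw [tangentCoordChange_self h] at h1
  exact h1

theorem differential_extChartAt_symm {π : M → ℝ} (hπ : IsFibration 𝓘(ℝ, E) π)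
    (v : TangentBundle 𝓘(ℝ, E) M) {y : E × E} (hy : y.1 ∈ (extChartAt 𝓘(ℝ, E) v.1).target) :
    differential 𝓘(ℝ, E) π ((extChartAt (𝓘(ℝ, E)).tangent v).symm y).1
        ((extChartAt (𝓘(ℝ, E)).tangent v).symm y).2 =
      fderiv ℝ (chartTime π v.1) y.1 y.2 := by
  have h := differential_tangentCoordChange ((extChartAt 𝓘(ℝ, E) v.1).map_target hy)
    (hπ.smooth.mdifferentiable (by simp) _) y.2
  rw [(extChartAt 𝓘(ℝ, E) v.1).right_inv hy] at h
  exact h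

theorem eventually_mem_jetSpace_iff {π : M → ℝ} (hπ : IsFibration 𝓘(ℝ, E) π)
    (v : TangentBundle 𝓘(ℝ, E) M) :
    ∀ᶠ y : E × E in 𝓝 (extChartAt 𝓘(ℝ, E) v.1 v.1, velocity v),
      y ∈ chartJet π v ↔
        fderiv ℝ (chartTime π v.1) y.1 y.2 = 1 := by
  filter_upwards [eventually_fst_mem_target v] with y hy
  exact iff_of_eq (congrArg (· = 1) (differential_extChartAt_symm hπ v hy))

/-- In the chart at `v = (q, w)`, the tangent space of `J^1π` consists of the vectors `(δq, δw)`
with `D²T(δq, w) + dT(δw) = 0`, where `T` is the local representative of `π`. -/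
theorem mem_jetTangent_iff {π : M → ℝ} (hπ : IsFibration 𝓘(ℝ, E) π)
    (v : TangentBundle 𝓘(ℝ, E) M) (a : E × E) :
    a ∈ jetTangent 𝓘(ℝ, E) π v ↔
      fderiv ℝ (fderiv ℝ (chartTime π v.1)) (extChartAt 𝓘(ℝ, E) v.1 v.1) a.1 (velocity v) +
        fderiv ℝ (chartTime π v.1) (extChartAt 𝓘(ℝ, E) v.1 v.1) a.2 = 0 := by
  set T := chartTime (E := E) π v.1
  set q := extChartAt 𝓘(ℝ, E) v.1 v.1
  set w : E := velocity v
  have h1 : HasFDerivAt (fderiv ℝ T) (fderiv ℝ (fderiv ℝ T) q) q :=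
    (((contDiffAt_chartTime hπ v.1).fderiv_right (m := 1)
      (by norm_cast)).differentiableAt (by norm_num)).hasFDerivAt
  have h2 : HasFDerivAt (fun y : E × E => fderiv ℝ T y.1)
      ((fderiv ℝ (fderiv ℝ T) q).comp (ContinuousLinearMap.fst ℝ E E)) (q, w) :=
    HasFDerivAt.comp (q, w) (f := Prod.fst) h1 hasFDerivAt_fst
  obtain ⟨A, h3, hA⟩ : ∃ A : E × E →L[ℝ] ℝ, HasFDerivAt (fun y : E × E => fderiv ℝ T y.1 y.2) A
      (q, w) ∧ ∀ a, A a = fderiv ℝ T q a.2 + fderiv ℝ (fderiv ℝ T) q a.1 w :=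
    ⟨_, h2.clm_apply (hasFDerivAt_snd (𝕜 := ℝ) (p := (q, w))), fun _ => rfl⟩
  have h4 : (fun y : TangentBundle 𝓘(ℝ, E) M => differential 𝓘(ℝ, E) π y.1 y.2) =ᶠ[𝓝 v]
      (fun y : E × E => fderiv ℝ T y.1 y.2) ∘ extChartAt (𝓘(ℝ, E)).tangent v := by
    filter_upwards [extChartAt_source_mem_nhds (I := (𝓘(ℝ, E)).tangent) v] with y hy
    have := differential_extChartAt_symm hπ v
      (y := extChartAt (𝓘(ℝ, E)).tangent v y) ((extChartAt 𝓘(ℝ, E) v.1).map_source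
        (mem_extChartAt_tangentBundle_source.1 hy))
    rw [(extChartAt (𝓘(ℝ, E)).tangent v).left_inv hy] at this
    exact this
  have h5 : HasMFDerivAt (𝓘(ℝ, E)).tangent 𝓘(ℝ, ℝ)
      (fun y : TangentBundle 𝓘(ℝ, E) M => differential 𝓘(ℝ, E) π y.1 y.2) v A := by
    refine ⟨(ContinuousAt.comp ?_ (continuousAt_extChartAt v)).congr h4.symm, ?_⟩
    · rw [extChartAt_tangentBundle_self]
      exact h3.continuousAt
    · rw [extChartAt_tangentBundle_self]
      refine (h3.congr_of_eventuallyEq ?_).hasFDerivWithinAt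
      filter_upwards [eventually_fst_mem_target v] with y hy using
        differential_extChartAt_symm hπ v hy
  have h6 := (DFunLike.congr_fun h5.mfderiv a).trans (hA a)
  rw [add_comm, ← h6]
  rfl

theorem differentiableWithinAt_lagrangian {π : M → ℝ} {L : TangentBundle 𝓘(ℝ, E) M → ℝ}
    (hL : ContMDiffOn (𝓘(ℝ, E)).tangent 𝓘(ℝ, ℝ) ∞ L (jetSpace 𝓘(ℝ, E) π))
    {v : TangentBundle 𝓘(ℝ, E) M} (hv : v ∈ jetSpace 𝓘(ℝ, E) π) :
    DifferentiableWithinAt ℝ (chartLagrangian L v) (chartJet π v)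
      (extChartAt 𝓘(ℝ, E) v.1 v.1, velocity v) := by
  have h := ((hL v hv).mdifferentiableWithinAt (by simp)).differentiableWithinAt_writtenInExtChartAt
  rw [ModelWithCorners.range_eq_univ, Set.inter_univ, extChartAt_tangentBundle_self] at h
  exact h

theorem mfderivWithin_lagrangian {π : M → ℝ} {L : TangentBundle 𝓘(ℝ, E) M → ℝ}
    (hL : ContMDiffOn (𝓘(ℝ, E)).tangent 𝓘(ℝ, ℝ) ∞ L (jetSpace 𝓘(ℝ, E) π))
    {v : TangentBundle 𝓘(ℝ, E) M} (hv : v ∈ jetSpace 𝓘(ℝ, E) π) :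
    mfderivWithin (𝓘(ℝ, E)).tangent 𝓘(ℝ, ℝ) L (jetSpace 𝓘(ℝ, E) π) v =
      chartLagrangianDeriv π L v := by
  rw [((hL v hv).mdifferentiableWithinAt (by simp)).mfderivWithin,
    ModelWithCorners.range_eq_univ, Set.inter_univ, extChartAt_tangentBundle_self]
  rfl


/-! ### The energy function -/

section Legendre

variable {π : M → ℝ} {L : TangentBundle 𝓘(ℝ, E) M → ℝ}
  {G : CotangentBundle 𝓘(ℝ, E) M → TangentBundle 𝓘(ℝ, E) M}

/-- The pairing of a covector and a vector at the same point can be computed in any chart. -/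
theorem momentum_velocity_eq {α β : CotangentBundle 𝓘(ℝ, E) M} {v w : TangentBundle 𝓘(ℝ, E) M}
    (hv : v.1 = α.1) (hw : w.1 = β.1) (h : β.1 ∈ (extChartAt 𝓘(ℝ, E) α.1).source) :
    (extChartAt (cotModel E) α β).2 (extChartAt (𝓘(ℝ, E)).tangent v w).2 =
      momentum β (velocity w) := by
  rw [extChartAt_cotangentBundle_snd h, extChartAt_tangentBundle_apply, hv, hw]
  refine congrArg (momentum β) ?_
  exact (tangentCoordChange_comp ⟨⟨mem_extChartAt_source _, h⟩, mem_extChartAt_source _⟩).trans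
    (tangentCoordChange_self (mem_extChartAt_source _))

theorem contMDiff_momentum_velocity (hG : ContMDiff (cotModel E) (𝓘(ℝ, E)).tangent ∞ G)
    (hGp : ∀ α, (G α).1 = α.1) :
    ContMDiff (cotModel E) 𝓘(ℝ, ℝ) ∞ (fun α => momentum α (velocity (G α))) := by
  intro α
  have h1 : ContMDiffAt (cotModel E) 𝓘(ℝ, E →L[ℝ] ℝ) ∞
      (fun β => (extChartAt (cotModel E) α β).2) α :=
    contDiff_snd.contMDiff.contMDiffAt.comp α (contMDiffAt_extChartAt (I := cotModel E))
  have h2 : ContMDiffAt (cotModel E) 𝓘(ℝ, E) ∞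
      (fun β => (extChartAt (𝓘(ℝ, E)).tangent (G α) (G β)).2) α :=
    contDiff_snd.contMDiff.contMDiffAt.comp α
      (ContMDiffAt.comp α (contMDiffAt_extChartAt (I := (𝓘(ℝ, E)).tangent)) (hG α))
  refine (h1.clm_apply h2).congr_of_eventuallyEq ?_
  filter_upwards [extChartAt_source_mem_nhds (I := cotModel E) α] with β hβ
  exact (momentum_velocity_eq (hGp α) (hGp β)
    (mem_extChartAt_cotangentBundle_source.1 hβ)).symm

theorem extChartAt_cotangentBundle_self (α : CotangentBundle 𝓘(ℝ, E) M) :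
    extChartAt (cotModel E) α α = (extChartAt 𝓘(ℝ, E) α.1 α.1, momentum α) := by
  refine Prod.ext rfl (ContinuousLinearMap.ext fun u => ?_)
  refine (extChartAt_cotangentBundle_snd (mem_extChartAt_source _) u).trans ?_
  rw [tangentCoordChange_self (mem_extChartAt_source _)]

/-- The differential of the energy `F(α) = α(G α) - L(G α)` at a covector `α` that is the Legendre
transform of the jet `v = G α` up to a multiple of `η`, in the charts at `α` and `v`. -/
theorem differential_energy (hπ : IsFibration 𝓘(ℝ, E) π)
    (hL : ContMDiffOn (𝓘(ℝ, E)).tangent 𝓘(ℝ, ℝ) ∞ L (jetSpace 𝓘(ℝ, E) π))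
    (hG : ContMDiff (cotModel E) (𝓘(ℝ, E)).tangent ∞ G)
    (hGp : ∀ α, (G α).1 = α.1) (hGJ : ∀ α, G α ∈ jetSpace 𝓘(ℝ, E) π)
    {F : CotangentBundle 𝓘(ℝ, E) M → ℝ} (hFs : ContMDiff (cotModel E) 𝓘(ℝ, ℝ) ∞ F)
    (hF : ∀ α, F α = momentum α (velocity (G α)) - L (G α))
    {α : CotangentBundle 𝓘(ℝ, E) M} {v : TangentBundle 𝓘(ℝ, E) M} (hvα : v.1 = α.1)
    (hv : G α = v) {F₀ : ℝ}
    (hα : ∀ u : E, momentum α u =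
      F₀ * fderiv ℝ (chartTime π v.1) (extChartAt 𝓘(ℝ, E) v.1 v.1) u +
      chartLagrangianDeriv π L v (0, u - fderiv ℝ (chartTime π v.1)
          (extChartAt 𝓘(ℝ, E) v.1 v.1) u • velocity v))
    (δq : E) (δp : E →L[ℝ] ℝ) :
    differential (cotModel E) F α (δq, δp) = δp (velocity v) -
      (F₀ * fderiv ℝ (fderiv ℝ (chartTime π v.1)) (extChartAt 𝓘(ℝ, E) v.1 v.1) δq (velocity v) +
        chartLagrangianDeriv π L v (δq, -(fderiv ℝ (fderiv ℝ (chartTime π v.1))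
          (extChartAt 𝓘(ℝ, E) v.1 v.1) δq (velocity v) • velocity v))) := by
  set q := extChartAt 𝓘(ℝ, E) v.1 v.1 with hq
  set p := momentum α
  have hself : extChartAt (cotModel E) α α = (q, p) := by
    rw [extChartAt_cotangentBundle_self, hq, hvα]
  -- the fibre component of `G` in the charts at `α` and `v`
  let g : E × (E →L[ℝ] ℝ) → E := fun y =>
    (extChartAt (𝓘(ℝ, E)).tangent v (G ((extChartAt (cotModel E) α).symm y))).2
  have hgd : DifferentiableAt ℝ g (q, p) := by
    have h := ((hG α).mdifferentiableAt (by simp)).differentiableWithinAt_writtenInExtChartAt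
    rw [ModelWithCorners.range_eq_univ, differentiableWithinAt_univ, hself, writtenInExtChartAt,
      hv] at h
    exact differentiableAt_snd.comp _ h
  have hg₀ : g (q, p) = velocity v := by
    simp only [g]
    rw [← hself, (extChartAt (cotModel E) α).left_inv (mem_extChartAt_source _), hv]
    exact congrArg Prod.snd (extChartAt_tangentBundle_self v)
  have htarget : ∀ᶠ y in 𝓝 (q, p), y ∈ (extChartAt (cotModel E) α).target :=
    hself ▸ extChartAt_target_mem_nhds (I := cotModel E) α
  have hsource : ∀ y ∈ (extChartAt (cotModel E) α).target,
      ((extChartAt (cotModel E) α).symm y).1 ∈ (extChartAt 𝓘(ℝ, E) α.1).source := fun y hy =>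
    mem_extChartAt_cotangentBundle_source.1 ((extChartAt (cotModel E) α).map_target hy)
  have hGy : ∀ y ∈ (extChartAt (cotModel E) α).target,
      (extChartAt (𝓘(ℝ, E)).tangent v).symm (y.1, g y) =
        G ((extChartAt (cotModel E) α).symm y) := by
    intro y hy
    have h1 : extChartAt (𝓘(ℝ, E)).tangent v (G ((extChartAt (cotModel E) α).symm y)) =
        (y.1, g y) := by
      refine Prod.ext ?_ rfl
      change extChartAt 𝓘(ℝ, E) v.1 (G _).1 = y.1
      rw [hGp, hvα]
      exact congrArg Prod.fst ((extChartAt (cotModel E) α).right_inv hy)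
    rw [← h1, (extChartAt (𝓘(ℝ, E)).tangent v).left_inv]
    rw [mem_extChartAt_tangentBundle_source, hGp, hvα]
    exact hsource y hy
  have hgJ : ∀ᶠ y in 𝓝 (q, p), (y.1, g y) ∈ chartJet π v := by
    filter_upwards [htarget] with y hy
    rw [chartJet, Set.mem_preimage, hGy y hy]
    exact hGJ _
  have hFg : F ∘ (extChartAt (cotModel E) α).symm =ᶠ[𝓝 (q, p)]
      fun y => y.2 (g y) - chartLagrangian L v (y.1, g y) := by
    filter_upwards [htarget] with y hy
    have h1 := momentum_velocity_eq hvα (hGp ((extChartAt (cotModel E) α).symm y)) (hsource y hy)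
    rw [(extChartAt (cotModel E) α).right_inv hy] at h1
    rw [chartLagrangian, Function.comp_apply, Function.comp_apply, hGy y hy, hF, ← h1]
  have hT : DifferentiableAt ℝ (fderiv ℝ (chartTime π v.1)) q :=
    ((contDiffAt_chartTime hπ v.1).fderiv_right (m := 1)
      (by norm_cast)).differentiableAt (by norm_num)
  have h := fderiv_energy (eventually_mem_jetSpace_iff hπ v)
    (differentiableWithinAt_lagrangian hL (hv ▸ hGJ α)) hT hgd hg₀ hgJ hα δq δp
  rw [chartLagrangianDeriv, ← h, ← hFg.fderiv_eq, ← hself]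
  have h2 := differential_tangentCoordChange (I := cotModel E) (mem_extChartAt_source α)
    (hFs.mdifferentiable (by simp) α) (δq, δp)
  rw [tangentCoordChange_self (mem_extChartAt_source _)] at h2
  exact h2

end Legendre

end Jets

/-! ### Hyperregular Lagrangians -/

section Hyperregular

variable {E : Type*} [NormedAddCommGroup E] [NormedSpace ℝ E]
  {M : Type*} [TopologicalSpace M] [ChartedSpace E M] [IsManifold 𝓘(ℝ, E) ∞ M]
  {π : M → ℝ} {L : TangentBundle 𝓘(ℝ, E) M → ℝ}

theorem fderiv_chartTime_velocity (hπ : IsFibration 𝓘(ℝ, E) π) {v : TangentBundle 𝓘(ℝ, E) M}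
    (hv : v ∈ jetSpace 𝓘(ℝ, E) π) :
    fderiv ℝ (chartTime π v.1) (extChartAt 𝓘(ℝ, E) v.1 v.1) (velocity v) = 1 :=
  (differential_eq_fderiv hπ v.1 (velocity v)).symm.trans hv

/-- The extended Legendre transformation in the chart at `v`. -/
theorem momentum_Leg (hπ : IsFibration 𝓘(ℝ, E) π)
    (hL : ContMDiffOn (𝓘(ℝ, E)).tangent 𝓘(ℝ, ℝ) ∞ L (jetSpace 𝓘(ℝ, E) π))
    (v : jetSpace 𝓘(ℝ, E) π) (u : E) :
    momentum (Leg π L v) u =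
      L v.1 * fderiv ℝ (chartTime π v.1.1) (extChartAt 𝓘(ℝ, E) v.1.1 v.1.1) u +
      chartLagrangianDeriv π L v.1 (0, u - fderiv ℝ (chartTime π v.1.1)
          (extChartAt 𝓘(ℝ, E) v.1.1 v.1.1) u • velocity v.1) := by
  have h1 := (hasFDerivAt_fibre (eventually_mem_jetSpace_iff hπ v.1)
    (differentiableWithinAt_lagrangian hL v.2) (fderiv_chartTime_velocity hπ v.2)).fderiv
  have h2 : (fun X : E => L ⟨v.1.1, velocity v.1 +
      (X - differential 𝓘(ℝ, E) π v.1.1 X • velocity v.1)⟩) =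
      fun X => chartLagrangian L v.1 (extChartAt 𝓘(ℝ, E) v.1.1 v.1.1, velocity v.1 +
        (X - fderiv ℝ (chartTime π v.1.1) (extChartAt 𝓘(ℝ, E) v.1.1 v.1.1) X • velocity v.1)) := by
    funext X
    rw [← differential_eq_fderiv hπ]
    have h3 : ∀ y : E, (extChartAt (𝓘(ℝ, E)).tangent v.1).symm
        (extChartAt 𝓘(ℝ, E) v.1.1 v.1.1, y) = ⟨v.1.1, y⟩ := by
      intro y
      refine (congrArg _ (extChartAt_tangentBundle_self (⟨v.1.1, y⟩ :
        TangentBundle 𝓘(ℝ, E) M)).symm).trans ?_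
      exact (extChartAt (𝓘(ℝ, E)).tangent v.1).left_inv
        (mem_extChartAt_tangentBundle_source.2 (mem_extChartAt_source _))
    rw [chartLagrangian, Function.comp_apply, h3]
  have h4 : momentum (Leg π L v) u = L v.1 * differential 𝓘(ℝ, E) π v.1.1 u +
      fderiv ℝ (fun X : E => L ⟨v.1.1, velocity v.1 +
        (X - differential 𝓘(ℝ, E) π v.1.1 X • velocity v.1)⟩) 0 u := rfl
  rw [h4, h2, h1, differential_eq_fderiv hπ]
  rfl

theorem momentum_translate (hπ : IsFibration 𝓘(ℝ, E) π) (s : ℝ)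
    (α : CotangentBundle 𝓘(ℝ, E) M) (u : E) :
    momentum (translate π s α) u = momentum α u +
      s * fderiv ℝ (chartTime π α.1) (extChartAt 𝓘(ℝ, E) α.1 α.1) u := by
  rw [← differential_eq_fderiv hπ]; rfl

/-- The map `leg_L⁻¹ ∘ μ : T^*M → J^1π` of a hyperregular Lagrangian `L`. -/
def legInverse (hreg : IsHyperregular π L) (α : CotangentBundle 𝓘(ℝ, E) M) :
    jetSpace 𝓘(ℝ, E) π :=
  (Equiv.ofBijective (leg π L) hreg.bijective).symm (mu π α)

variable (hreg : IsHyperregular π L)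

theorem leg_legInverse (α : CotangentBundle 𝓘(ℝ, E) M) :
    leg π L (legInverse hreg α) = mu π α :=
  (Equiv.ofBijective (leg π L) hreg.bijective).apply_symm_apply (mu π α)

theorem legInverse_eq_iff {α : CotangentBundle 𝓘(ℝ, E) M} {v : jetSpace 𝓘(ℝ, E) π} :
    legInverse hreg α = v ↔ mu π α = leg π L v :=
  (Equiv.ofBijective (leg π L) hreg.bijective).symm_apply_eq

theorem legInverse_proj (α : CotangentBundle 𝓘(ℝ, E) M) : (legInverse hreg α).1.1 = α.1 :=
  congrArg Sigma.fst (leg_legInverse hreg α)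

/-- The identity `α = Leg_L(v) + F_h(α) η`, for `leg_L(v) = μ(α)`, in the chart at `v`. -/
theorem momentum_eq (hπ : IsFibration 𝓘(ℝ, E) π)
    (hL : ContMDiffOn (𝓘(ℝ, E)).tangent 𝓘(ℝ, ℝ) ∞ L (jetSpace 𝓘(ℝ, E) π))
    {α : CotangentBundle 𝓘(ℝ, E) M} {v : jetSpace 𝓘(ℝ, E) π} (hv : legInverse hreg α = v) (u : E) :
    momentum α u = (L v.1 + sectionFunction π (hamiltonianSection hreg) α) *
        fderiv ℝ (chartTime π v.1.1) (extChartAt 𝓘(ℝ, E) v.1.1 v.1.1) u +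
      chartLagrangianDeriv π L v.1 (0, u - fderiv ℝ (chartTime π v.1.1)
          (extChartAt 𝓘(ℝ, E) v.1.1 v.1.1) u • velocity v.1) := by
  subst hv
  have h1 : ∀ β, mu π (hamiltonianSection hreg β) = β :=
    (Equiv.ofBijective (leg π L) hreg.bijective).apply_symm_apply
  have h2 : α = translate π (sectionFunction π (hamiltonianSection hreg) α)
      (Leg π L (legInverse hreg α)) := (sectionFunction_spec hπ h1 α _).2 rfl
  have h3 := congrArg (fun β => momentum β u) h2
  refine h3.trans ?_
  rw [momentum_translate hπ, momentum_Leg hπ hL]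
  change _ + _ * fderiv ℝ (chartTime π (legInverse hreg α).1.1) (extChartAt 𝓘(ℝ, E)
    (legInverse hreg α).1.1 (legInverse hreg α).1.1) u = _
  ring

theorem sectionFunction_eq (hπ : IsFibration 𝓘(ℝ, E) π)
    (hL : ContMDiffOn (𝓘(ℝ, E)).tangent 𝓘(ℝ, ℝ) ∞ L (jetSpace 𝓘(ℝ, E) π))
    (α : CotangentBundle 𝓘(ℝ, E) M) :
    sectionFunction π (hamiltonianSection hreg) α =
      momentum α (velocity (legInverse hreg α).1) - L (legInverse hreg α).1 := by
  have h0 : ((0 : E), (0 : E)) = 0 := rfl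
  rw [momentum_eq hreg hπ hL rfl, fderiv_chartTime_velocity hπ (legInverse hreg α).2, one_smul,
    sub_self, h0, map_zero]
  ring

theorem contMDiff_sectionFunction (hπ : IsFibration 𝓘(ℝ, E) π)
    (hL : ContMDiffOn (𝓘(ℝ, E)).tangent 𝓘(ℝ, ℝ) ∞ L (jetSpace 𝓘(ℝ, E) π)) :
    ContMDiff (cotModel E) 𝓘(ℝ, ℝ) ∞ (sectionFunction π (hamiltonianSection hreg)) := by
  rw [funext (sectionFunction_eq hreg hπ hL)]
  exact (contMDiff_momentum_velocity hreg.smooth_symm (legInverse_proj hreg)).sub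
    (hL.comp_contMDiff hreg.smooth_symm fun α => (legInverse hreg α).2)

theorem differential_sectionFunction (hπ : IsFibration 𝓘(ℝ, E) π)
    (hL : ContMDiffOn (𝓘(ℝ, E)).tangent 𝓘(ℝ, ℝ) ∞ L (jetSpace 𝓘(ℝ, E) π))
    {α : CotangentBundle 𝓘(ℝ, E) M} {v : jetSpace 𝓘(ℝ, E) π} (hv : legInverse hreg α = v)
    (δq : E) (δp : E →L[ℝ] ℝ) :
    differential (cotModel E) (sectionFunction π (hamiltonianSection hreg)) α (δq, δp) =
      δp (velocity v.1) - ((L v.1 + sectionFunction π (hamiltonianSection hreg) α) *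
          fderiv ℝ (fderiv ℝ (chartTime π v.1.1)) (extChartAt 𝓘(ℝ, E) v.1.1 v.1.1) δq
            (velocity v.1) +
        chartLagrangianDeriv π L v.1 (δq, -(fderiv ℝ (fderiv ℝ (chartTime π v.1.1))
          (extChartAt 𝓘(ℝ, E) v.1.1 v.1.1) δq (velocity v.1) • velocity v.1))) :=
  differential_energy hπ hL hreg.smooth_symm (legInverse_proj hreg)
    (fun α => (legInverse hreg α).2) (contMDiff_sectionFunction hreg hπ hL)
    (sectionFunction_eq hreg hπ hL) (hv ▸ legInverse_proj hreg α) (congrArg Subtype.val hv)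
    (momentum_eq hreg hπ hL hv) δq δp

/-- The fibre derivative of `F_h` is `leg_L⁻¹ ∘ μ`. -/
theorem differential_sectionFunction_vertical (hπ : IsFibration 𝓘(ℝ, E) π)
    (hL : ContMDiffOn (𝓘(ℝ, E)).tangent 𝓘(ℝ, ℝ) ∞ L (jetSpace 𝓘(ℝ, E) π))
    (α : CotangentBundle 𝓘(ℝ, E) M) (δp : E →L[ℝ] ℝ) :
    differential (cotModel E) (sectionFunction π (hamiltonianSection hreg)) α ((0 : E), δp) =
      δp (velocity (legInverse hreg α).1) := by
  have h0 : ((0 : E), (0 : E)) = 0 := rfl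
  rw [differential_sectionFunction hreg hπ hL rfl, map_zero, _root_.zero_apply, zero_smul,
    neg_zero, mul_zero, h0, map_zero, add_zero, sub_zero]

theorem mem_jetSpace_cotTime_iff (hπ : IsFibration 𝓘(ℝ, E) π)
    {z : TangentBundle (cotModel E) (CotangentBundle 𝓘(ℝ, E) M)} :
    z ∈ jetSpace (cotModel E) (cotTime (E := E) π) ↔
      tangentMap (cotModel E) 𝓘(ℝ, E) (cotProj M) z ∈ jetSpace 𝓘(ℝ, E) π := by
  have h1 : MDifferentiableAt (cotModel E) 𝓘(ℝ, E) (cotProj (E := E) M) z.1 :=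
    (Bundle.contMDiff_proj (n := 1) _).mdifferentiable (by norm_num) z.1
  have h2 : MDifferentiableAt 𝓘(ℝ, E) 𝓘(ℝ, ℝ) π (cotProj M z.1) :=
    hπ.smooth.mdifferentiable (by simp) _
  exact iff_of_eq (congrArg (· = (1 : ℝ)) (DFunLike.congr_fun (mfderiv_comp z.1 h2 h1) z.2))

/-- The components `(q̇, ṗ)` of a vector tangent to `T^*M` in the preferred chart at its base
point. -/
def fibreComponents (z : TangentBundle (cotModel E) (CotangentBundle 𝓘(ℝ, E) M)) :
    E × (E →L[ℝ] ℝ) := z.2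

theorem fibreComponents_hamiltonianField [FiniteDimensional ℝ E]
    (F : CotangentBundle 𝓘(ℝ, E) M → ℝ) (α : CotangentBundle 𝓘(ℝ, E) M) (δq : E)
    (δp : E →L[ℝ] ℝ) :
    δp (fibreComponents (hamiltonianField F α)).1 - (fibreComponents (hamiltonianField F α)).2 δq =
      differential (cotModel E) F α (δq, δp) :=
  DFunLike.congr_fun (darboux_darbouxEquiv_symm (differential (cotModel E) F α)) (δq, δp)

theorem velocity_tangentMap_cotProj
    (z : TangentBundle (cotModel E) (CotangentBundle 𝓘(ℝ, E) M)) :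
    velocity (tangentMap (cotModel E) 𝓘(ℝ, E) (cotProj M) z) = (fibreComponents z).1 := by
  rw [tangentMap_cotProj]; rfl

/-- The equation `ṗ(δq) + p(δw) = dL(δq, δw)` of `S̃_L`, required of the vectors `(δq, δw)` tangent
to `J^1π`, in the chart at `v`. -/
theorem mem_lagrangianSet_iff (hπ : IsFibration 𝓘(ℝ, E) π)
    (hL : ContMDiffOn (𝓘(ℝ, E)).tangent 𝓘(ℝ, ℝ) ∞ L (jetSpace 𝓘(ℝ, E) π))
    {z : jetSpace (cotModel E) (cotTime (E := E) π)} {v : jetSpace 𝓘(ℝ, E) π}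
    (hv : jetProj hπ z = v) :
    z ∈ lagrangianSet hπ L ↔ ∀ δq δw : E,
      fderiv ℝ (fderiv ℝ (chartTime π v.1.1)) (extChartAt 𝓘(ℝ, E) v.1.1 v.1.1) δq (velocity v.1) +
        fderiv ℝ (chartTime π v.1.1) (extChartAt 𝓘(ℝ, E) v.1.1 v.1.1) δw = 0 →
      (fibreComponents z.1).2 δq + momentum z.1.1 δw = chartLagrangianDeriv π L v.1 (δq, δw) := by
  subst hv
  have h1 : z ∈ lagrangianSet hπ L ↔
      tulczyjewFibration hπ z = lagrangianDifferential π L (jetProj hπ z) := by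
    constructor
    · rintro ⟨v, hv⟩
      obtain rfl : v = jetProj hπ z := congrArg Sigma.fst hv
      exact hv.symm
    · exact fun h => ⟨_, h.symm⟩
  have h2 := mfderivWithin_lagrangian hL (jetProj hπ z).2
  rw [h1, tulczyjewFibration, lagrangianDifferential, Sigma.mk.injEq]
  simp only [heq_eq_eq, true_and]
  constructor
  · intro h δq δw ha
    have h3 := DFunLike.congr_fun h
      ⟨(δq, δw), (mem_jetTangent_iff hπ (jetProj hπ z).1 (δq, δw)).2 ha⟩
    exact h3.trans (DFunLike.congr_fun h2 (δq, δw))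
  · intro h
    refine ContinuousLinearMap.ext fun a => ?_
    refine (h _ _ ((mem_jetTangent_iff hπ (jetProj hπ z).1 a.1).1 a.2)).trans ?_
    exact (DFunLike.congr_fun h2 a.1).symm

/-- Hamilton's equations `q̇ = ∂F/∂p`, `ṗ = -∂F/∂q`, in weak form, for `F = F_h`. -/
theorem mem_hamiltonianSet_iff {h : VerticalDual (E := E) π → CotangentBundle 𝓘(ℝ, E) M}
    {z : jetSpace (cotModel E) (cotTime (E := E) π)} :
    z ∈ hamiltonianSet π h ↔ ∀ (δq : E) (δp : E →L[ℝ] ℝ),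
      δp (fibreComponents z.1).1 - (fibreComponents z.1).2 δq =
        differential (cotModel E) (sectionFunction π h) z.1.1 (δq, δp) := by
  constructor
  · rintro ⟨α, hα⟩ δq δp
    obtain rfl : α = z.1.1 := congrArg Bundle.TotalSpace.proj hα
    exact (DFunLike.congr_fun (eq_of_heq (Bundle.TotalSpace.mk.inj hα).2) (δq, δp)).symm
  · intro h'
    refine ⟨z.1.1, congrArg (Bundle.TotalSpace.mk z.1.1) ?_⟩
    exact ContinuousLinearMap.ext fun b => (h' b.1 b.2).symm

/-! ### The two Lagrangian submanifolds -/

theorem lagrangianSet_eq_hamiltonianSet (hπ : IsFibration 𝓘(ℝ, E) π)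
    (hL : ContMDiffOn (𝓘(ℝ, E)).tangent 𝓘(ℝ, ℝ) ∞ L (jetSpace 𝓘(ℝ, E) π)) :
    lagrangianSet hπ L = hamiltonianSet π (hamiltonianSection hreg) := by
  ext z
  have hvel : velocity (jetProj hπ z).1 = (fibreComponents z.1).1 :=
    velocity_tangentMap_cotProj z.1
  rw [mem_lagrangianSet_iff hπ hL rfl, mem_hamiltonianSet_iff]
  have hone := fderiv_chartTime_velocity hπ (jetProj hπ z).2
  constructor
  · intro h δq δp
    have hv : legInverse hreg z.1.1 = jetProj hπ z := by
      -- on vertical vectors the equation of `S̃_L` says that `α` and `Leg_L(v)` agree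
      have hker : ∀ u : E, fderiv ℝ (chartTime π (jetProj hπ z).1.1) (extChartAt 𝓘(ℝ, E)
          (jetProj hπ z).1.1 (jetProj hπ z).1.1) u = 0 →
          momentum z.1.1 u = momentum (Leg π L (jetProj hπ z)) u := by
        intro u hu
        have h1 := h 0 u (by rw [map_zero, hu]; exact zero_add _)
        rw [momentum_Leg hπ hL, hu, zero_smul, sub_zero, mul_zero, zero_add, ← h1, map_zero,
          zero_add]
      refine (legInverse_eq_iff hreg).2 (congrArg (Sigma.mk z.1.1.1) ?_)
      exact ContinuousLinearMap.ext fun k =>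
        hker k.1 ((differential_eq_fderiv hπ _ _).symm.trans k.2)
    rw [differential_sectionFunction hreg hπ hL hv, ← hvel]
    set c := fderiv ℝ (fderiv ℝ (chartTime π (jetProj hπ z).1.1)) (extChartAt 𝓘(ℝ, E)
      (jetProj hπ z).1.1 (jetProj hπ z).1.1) δq (velocity (jetProj hπ z).1)
    -- `(δq, -c w)` is the lift of `δq` to `T_v J^1π` along `w`
    have h1 := h δq (-(c • velocity (jetProj hπ z).1)) (by rw [map_neg, map_smul, hone]; simp [c])
    have h2 := sectionFunction_eq hreg hπ hL z.1.1
    rw [hv] at h2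
    rw [← h1, h2, map_neg, map_smul, smul_eq_mul]
    ring
  · intro h δq δw ha
    have hv : legInverse hreg z.1.1 = jetProj hπ z := by
      -- the equation on vertical vectors is `q̇ = ∂F/∂p`
      refine Subtype.ext (tangentBundle_ext (legInverse_proj hreg _) ?_)
      rw [hvel]
      refine (SeparatingDual.eq_iff_forall_dual_eq (R := ℝ)).2 fun δp => ?_
      have h1 := h 0 δp
      rw [differential_sectionFunction_vertical hreg hπ hL, map_zero, sub_zero] at h1
      exact h1.symm
    have h1 := h δq 0
    rw [differential_sectionFunction hreg hπ hL hv] at h1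
    have h2 := momentum_eq hreg hπ hL hv δw
    set D := chartLagrangianDeriv π L (jetProj hπ z).1
    set c := fderiv ℝ (fderiv ℝ (chartTime π (jetProj hπ z).1.1)) (extChartAt 𝓘(ℝ, E)
      (jetProj hπ z).1.1 (jetProj hπ z).1.1) δq (velocity (jetProj hπ z).1)
    rw [eq_neg_of_add_eq_zero_right ha] at h2
    -- decompose `(δq, δw)` into the lift of `δq` along `w` and a vertical vector
    have h3 : ((δq, δw) : E × E) = (δq, -(c • velocity (jetProj hπ z).1)) +
        (0, δw - (-c) • velocity (jetProj hπ z).1) := by simp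
    rw [h3, map_add, h2]
    simp only [_root_.zero_apply, zero_sub] at h1
    linarith

end Hyperregular

section Main

variable {E : Type} [NormedAddCommGroup E] [NormedSpace ℝ E] [FiniteDimensional ℝ E]
  {M : Type u} [TopologicalSpace M] [ChartedSpace E M] [IsManifold 𝓘(ℝ, E) ∞ M]
  {π : M → ℝ} {L : TangentBundle 𝓘(ℝ, E) M → ℝ}

theorem isLagrangianInJet_hamiltonianSet (hπ : IsFibration 𝓘(ℝ, E) π)
    (hL : ContMDiffOn (𝓘(ℝ, E)).tangent 𝓘(ℝ, ℝ) ∞ L (jetSpace 𝓘(ℝ, E) π))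
    (hreg : IsHyperregular π L) :
    IsLagrangianInJet π (hamiltonianSet π (hamiltonianSection hreg)) := by
  refine isLagrangianInJet_range_hamiltonianField (contMDiff_sectionFunction hreg hπ hL) ?_
  set F := sectionFunction π (hamiltonianSection hreg)
  have hcomp := fibreComponents_hamiltonianField F
  ext z
  constructor
  · rintro ⟨α, rfl⟩
    have hvel : tangentMap (cotModel E) 𝓘(ℝ, E) (cotProj M) (hamiltonianField F α) =
        (legInverse hreg α).1 := by
      refine tangentBundle_ext (legInverse_proj hreg α).symm ?_
      rw [velocity_tangentMap_cotProj]
      refine (SeparatingDual.eq_iff_forall_dual_eq (R := ℝ)).2 fun δp => ?_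
      rw [← differential_sectionFunction_vertical hreg hπ hL, ← hcomp, map_zero, sub_zero]
    exact ⟨⟨hamiltonianField F α, (mem_jetSpace_cotTime_iff hπ).2
      (hvel ▸ (legInverse hreg α).2)⟩, mem_hamiltonianSet_iff.2 (hcomp α), rfl⟩
  · rintro ⟨z, hz, rfl⟩
    refine ⟨z.1.1, congrArg (Bundle.TotalSpace.mk z.1.1) ?_⟩
    refine (darbouxEquiv E).injective ?_
    refine (darboux_darbouxEquiv_symm _).trans (ContinuousLinearMap.ext fun b => ?_)
    exact (mem_hamiltonianSet_iff.1 hz b.1 b.2).symm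

end Main

end TimeDependentMechanics

end

open TimeDependentMechanics in
theorem mainTheorem6 {n : ℕ} {M : Type*} [TopologicalSpace M]
    [ChartedSpace (EuclideanSpace ℝ (Fin (n + 1))) M] [IsManifold (𝓡 (n + 1)) ∞ M]
    (π : M → ℝ) (hπ : IsFibration (𝓡 (n + 1)) π)
    (L : TangentBundle (𝓡 (n + 1)) M → ℝ)
    (hL : ContMDiffOn (𝓡 (n + 1)).tangent 𝓘(ℝ, ℝ) ∞ L (jetSpace (𝓡 (n + 1)) π))
    (hreg : IsHyperregular π L) :
    IsLagrangianInJet π (lagrangianSet hπ L) ∧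
      IsLagrangianInJet π (hamiltonianSet π (hamiltonianSection hreg)) ∧
      lagrangianSet hπ L = hamiltonianSet π (hamiltonianSection hreg) := by
  have heq := lagrangianSet_eq_hamiltonianSet hreg hπ hL
  have hh := isLagrangianInJet_hamiltonianSet hπ hL hreg
  exact ⟨heq ▸ hh, hh, heq⟩
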